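/- Let $R$ and $S$ be associative rings with unit and let ${}_R\omega_S$ be a semidualizing bimodule: an $(R,S)$-bimodule such that ${}_R\omega$ and $\omega_S$ have projective resolutions by finitely generated projective modules, the homothety maps $R\to\mathrm{Hom}_{S^{op}}(\omega,\omega)$ and $S\to\mathrm{Hom}_R(\omega,\omega)$ are bijective, and $\mathrm{Ext}^{i}_R(\omega,\omega)=0=\mathrm{Ext}^{i}_{S^{op}}(\omega,\omega)$ for all $i\ge1$. For a left $R$-module $M$ put $M_*=\mathrm{Hom}_R(\omega,M)$, a left $S$-module. The Bass class $\mathcal{B}_\omega(R)$ consists of the left $R$-modules $M$ such that $\mathrm{Ext}^i_R(\omega,M)=0$ for all $i\ge1$, $\mathrm{Tor}^S_i(\omega,M_*)=0$ for all $i\ge1$, and the evaluation map $\omega\otimes_SM_*\to M$, $x\otimes f\mapsto f(x)$, is an isomorphism. Let $\mathcal{P}_\omega(R)$ be the class of left $R$-modules isomorphic to $\omega\otimes_SP$ for some projective left $S$-module $P$. For a class $\mathcal{X}$ of left $R$-modules, $\mathcal{X}$-$\mathrm{id}\,M$ is the infimum of the integers $n\ge0$ for which there is an exact sequence $0\to M\to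 X^0\to\cdots\to X^n\to0$ with all $X^i\in\mathcal{X}$ ($\infty$ if there is none); $\mathcal{X}$-$\mathrm{id}\,M\le-1$ means $M=0$. Let $0\to M\to I^0\xrightarrow{f^0}I^1\xrightarrow{f^1}\cdots$ be a minimal injective resolution of $M$, and let $\mathrm{co}\Omega^0(M)=M$ and $\mathrm{co}\Omega^m(M)=\mathrm{Im}\,f^{m-1}$ for $m\ge1$. Let $M$ be a left $R$-module with $\mathcal{B}_\omega(R)$-$\mathrm{id}\,M<\infty$ and let $n\ge0$. Then the following statements are equivalent. 1. $\mathcal{B}_\omega(R)$-$\mathrm{id}\,M\le n$. 2. $\mathrm{co}\Omega^m(M)\in\mathcal{B}_\omega(R)$ for all $m\ge n$. 3. $\mathrm{Ext}^{i}_R(\omega,M)=0$ for all $i\ge n+1$. 4. There is an exact sequence $0\to M\to X\to W\to0$ of left $R$-modules with $X\in\mathcal{B}_\omega(R)$ and $\mathcal{P}_\omega(R)$-$\mathrm{id}\,W\le n-1$. 5. There is an exact sequence $0\to X\to W\to M\to0$ of left $R$-modules with $X\in\mathcal{B}_\omega(R)$ and $\mathcal{P}_\omega(R)$-$\mathrm{id}\,W\le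 n$. -/

import Mathlib

open CategoryTheory Limits

universe u

set_option linter.unusedSectionVars false

namespace BassDim

noncomputable section

section Tensor

open scoped TensorProduct

variable (R S ω : Type u) [Ring R] [Ring S] [AddCommGroup ω] [Module R ω] [Module Sᵐᵒᵖ ω]
  [SMulCommClass R Sᵐᵒᵖ ω]

/-- The balancing relations `(x s) ⊗ n - x ⊗ (s n)` inside `ω ⊗_ℤ N`. The set of these elements is
stable under `R` because `ω` is an `(R, S)`-bimodule, so the `R`-submodule that it spans is also
the additive subgroup that it spans. -/
def balanced (N : Type u) [AddCommGroup N] [Module S N] : Submodule R (ω ⊗[ℤ] N) :=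
  Submodule.span R {t | ∃ (x : ω) (s : S) (n : N),
    t = (MulOpposite.op s • x) ⊗ₜ[ℤ] n - x ⊗ₜ[ℤ] (s • n)}

/-- The tensor product `ω ⊗_S N` of the `(R, S)`-bimodule `ω` with the left `S`-module `N`, as a
left `R`-module. Right `S`-modules are modules over `Sᵐᵒᵖ`: `x s` is `MulOpposite.op s • x`. -/
abbrev BiTensor (N : Type u) [AddCommGroup N] [Module S N] : Type u :=
  (ω ⊗[ℤ] N) ⧸ balanced R S ω N

variable {S}

/-- The map `ω ⊗_ℤ N → ω ⊗_ℤ N'` induced by an `S`-linear map, as an `R`-linear map. -/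
def preMap {N N' : Type u} [AddCommGroup N] [Module S N] [AddCommGroup N'] [Module S N']
    (f : N →ₗ[S] N') : (ω ⊗[ℤ] N) →ₗ[R] (ω ⊗[ℤ] N') :=
  TensorProduct.AlgebraTensorModule.map LinearMap.id f.toAddMonoidHom.toIntLinearMap

@[simp] lemma preMap_tmul {N N' : Type u} [AddCommGroup N] [Module S N] [AddCommGroup N']
    [Module S N'] (f : N →ₗ[S] N') (x : ω) (n : N) :
    preMap R ω f (x ⊗ₜ n) = x ⊗ₜ f n := rfl

lemma balanced_le_comap {N N' : Type u} [AddCommGroup N] [Module S N] [AddCommGroup N']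
    [Module S N'] (f : N →ₗ[S] N') :
    balanced R S ω N ≤ (balanced R S ω N').comap (preMap R ω f) := by
  refine Submodule.span_le.2 ?_
  rintro _ ⟨x, s, n, rfl⟩
  refine Submodule.subset_span ⟨x, s, f n, ?_⟩
  simp

/-- `ω ⊗_S f` for an `S`-linear map `f`. -/
def tensorMap {N N' : Type u} [AddCommGroup N] [Module S N] [AddCommGroup N']
    [Module S N'] (f : N →ₗ[S] N') : BiTensor R S ω N →ₗ[R] BiTensor R S ω N' :=
  Submodule.mapQ _ _ (preMap R ω f) (balanced_le_comap R ω f)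

lemma tensor_hom_ext {N : Type u} [AddCommGroup N] [Module S N] {L : Type u} [AddCommGroup L]
    [Module R L] {g h : BiTensor R S ω N →ₗ[R] L}
    (H : ∀ (x : ω) (n : N), g (Submodule.Quotient.mk (x ⊗ₜ n)) =
      h (Submodule.Quotient.mk (x ⊗ₜ n))) : g = h := by
  refine LinearMap.ext fun t => ?_
  induction t using Submodule.Quotient.induction_on with
  | _ t =>
    induction t using TensorProduct.induction_on with
    | zero => simp
    | tmul x n => exact H x n
    | add a b ha hb => rw [Submodule.Quotient.mk_add, map_add, map_add, ha, hb]

lemma tensorMap_mk {N N' : Type u} [AddCommGroup N] [Module S N] [AddCommGroup N']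
    [Module S N'] (f : N →ₗ[S] N') (x : ω) (n : N) :
    tensorMap R ω f (Submodule.Quotient.mk (x ⊗ₜ n)) = Submodule.Quotient.mk (x ⊗ₜ f n) := rfl

variable (S)

/-- The functor `ω ⊗_S - : Mod S ⥤ Mod R`. -/
def tensorFunctor : ModuleCat.{u} S ⥤ ModuleCat.{u} R where
  obj N := ModuleCat.of R (BiTensor R S ω N)
  map f := ModuleCat.ofHom (tensorMap R ω f.hom)
  map_id N := by
    ext1
    exact tensor_hom_ext R ω fun x n => rfl
  map_comp f g := by
    ext1
    exact tensor_hom_ext R ω fun x n => rfl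

lemma tensorMap_add {N N' : Type u} [AddCommGroup N] [Module S N] [AddCommGroup N']
    [Module S N'] (f g : N →ₗ[S] N') :
    tensorMap R ω (f + g) = tensorMap R ω f + tensorMap R ω g := by
  refine tensor_hom_ext R ω fun x n => ?_
  rw [LinearMap.add_apply, tensorMap_mk, tensorMap_mk, tensorMap_mk, LinearMap.add_apply,
    TensorProduct.tmul_add, Submodule.Quotient.mk_add]

instance : (tensorFunctor R S ω).Additive where
  map_add {_ _ f g} := ModuleCat.hom_ext (tensorMap_add R S ω f.hom g.hom)

/-- `Tor_i^S(ω, N)`: the `i`-th left derived functor of `ω ⊗_S -`, computed in `Mod R`. -/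
def tor (i : ℕ) (N : ModuleCat.{u} S) : ModuleCat.{u} R :=
  ((tensorFunctor R S ω).leftDerived i).obj N

end Tensor

section Hom

variable (R S ω : Type u) [Ring R] [Ring S] [AddCommGroup ω] [Module R ω] [Module Sᵐᵒᵖ ω]
  [SMulCommClass R Sᵐᵒᵖ ω]

variable {R} in
/-- The homothety map `R → Hom_{Sᵒᵖ}(ω, ω)`, `r ↦ (x ↦ r x)`. -/
def homothetyLeft (r : R) : ω →ₗ[Sᵐᵒᵖ] ω where
  toFun x := r • x
  map_add' x y := smul_add r x y
  map_smul' t x := smul_comm r t x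

variable {S} in
/-- The homothety map `S → Hom_R(ω, ω)`, `s ↦ (x ↦ x s)`. -/
def homothetyRight (s : S) : ω →ₗ[R] ω where
  toFun x := MulOpposite.op s • x
  map_add' x y := smul_add (MulOpposite.op s) x y
  map_smul' r x := (smul_comm r (MulOpposite.op s) x).symm

/-- `M_* = Hom_R(ω, M)`, with its left `S`-module structure `(s f)(x) = f(x s)`. -/
@[nolint unusedArguments]
def Star (_S : Type u) (M : Type u) [AddCommGroup M] [Module R M] : Type u := ω →ₗ[R] M

instance (M : Type u) [AddCommGroup M] [Module R M] : AddCommGroup (Star R ω S M) :=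
  inferInstanceAs (AddCommGroup (ω →ₗ[R] M))

instance (M : Type u) [AddCommGroup M] [Module R M] : FunLike (Star R ω S M) ω M :=
  inferInstanceAs (FunLike (ω →ₗ[R] M) ω M)

instance (M : Type u) [AddCommGroup M] [Module R M] : Module S (Star R ω S M) where
  smul s f := LinearMap.comp (show ω →ₗ[R] M from f) (homothetyRight R ω s)
  one_smul f := LinearMap.ext fun x => congrArg f (one_smul Sᵐᵒᵖ x)
  mul_smul s t f := LinearMap.ext fun x =>
    congrArg f (mul_smul (MulOpposite.op t) (MulOpposite.op s) x)
  smul_zero _ := rfl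
  smul_add _ _ _ := rfl
  add_smul s t f := LinearMap.ext fun x =>
    (congrArg f (add_smul (MulOpposite.op s) (MulOpposite.op t) x)).trans
      (map_add (show ω →ₗ[R] M from f) _ _)
  zero_smul f := LinearMap.ext fun x =>
    (congrArg f (zero_smul Sᵐᵒᵖ x)).trans (map_zero (show ω →ₗ[R] M from f))

lemma star_smul_apply (M : Type u) [AddCommGroup M] [Module R M] (s : S) (f : Star R ω S M)
    (x : ω) : (s • f) x = f (MulOpposite.op s • x) := rfl

open scoped TensorProduct

/-- The evaluation `ω ⊗_ℤ Hom_R(ω, M) → M`, `x ⊗ f ↦ f x`, as an `R`-linear map. -/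
def preEval (M : Type u) [AddCommGroup M] [Module R M] : (ω ⊗[ℤ] Star R ω S M) →ₗ[R] M :=
  TensorProduct.AlgebraTensorModule.lift
    { toFun := fun x =>
        ({ toFun := fun f => f x, map_zero' := rfl, map_add' := fun _ _ => rfl } :
          Star R ω S M →+ M).toIntLinearMap
      map_add' := fun x y => LinearMap.ext fun f => map_add (show ω →ₗ[R] M from f) x y
      map_smul' := fun r x => LinearMap.ext fun f => map_smul (show ω →ₗ[R] M from f) r x }

/-- The evaluation homomorphism `θ_M : ω ⊗_S M_* → M`, `θ_M(x ⊗ f) = f(x)`. -/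
def theta (M : Type u) [AddCommGroup M] [Module R M] :
    BiTensor R S ω (Star R ω S M) →ₗ[R] M :=
  Submodule.liftQ _ (preEval R S ω M) <| by
    refine Submodule.span_le.2 ?_
    rintro _ ⟨x, s, f, rfl⟩
    change preEval R S ω M _ = 0
    rw [map_sub, sub_eq_zero]
    rfl

lemma theta_mk (M : Type u) [AddCommGroup M] [Module R M] (x : ω) (f : Star R ω S M) :
    theta R S ω M (Submodule.Quotient.mk (x ⊗ₜ f)) = f x := rfl

end Hom

/-- The left module `N` has a projective resolution by finitely generated projectives. -/
def HasDegreewiseFiniteResolution (A N : Type u) [Ring A] [AddCommGroup N] [Module A N] : Prop :=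
  ∃ P : ProjectiveResolution (ModuleCat.of A N), ∀ i, Module.Finite A (P.complex.X i)

section Bass

variable (R S ω : Type u) [Ring R] [Ring S] [AddCommGroup ω] [Module R ω] [Module Sᵐᵒᵖ ω]
  [SMulCommClass R Sᵐᵒᵖ ω]

/-- The `(R, S)`-bimodule `ω` is semidualizing. -/
structure IsSemidualizing : Prop where
  finite_left : HasDegreewiseFiniteResolution R ω
  finite_right : HasDegreewiseFiniteResolution Sᵐᵒᵖ ω
  homothety_left : Function.Bijective fun r : R => homothetyLeft S ω r
  homothety_right : Function.Bijective fun s : S => homothetyRight R ω s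
  ext_left : ∀ i : ℕ, 1 ≤ i → Subsingleton (Abelian.Ext (ModuleCat.of R ω) (ModuleCat.of R ω) i)
  ext_right : ∀ i : ℕ, 1 ≤ i →
    Subsingleton (Abelian.Ext (ModuleCat.of Sᵐᵒᵖ ω) (ModuleCat.of Sᵐᵒᵖ ω) i)

/-- The Bass class `𝓑_ω(R)`. -/
structure bassClass (M : ModuleCat.{u} R) : Prop where
  ext_eq_zero : ∀ i : ℕ, 1 ≤ i → Subsingleton (Abelian.Ext (ModuleCat.of R ω) M i)
  tor_eq_zero : ∀ i : ℕ, 1 ≤ i → IsZero (tor R S ω i (ModuleCat.of S (Star R ω S M)))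
  static : Function.Bijective (theta R S ω M)

/-- The class `𝓟_ω(R)` of `ω`-projective modules: those isomorphic to `ω ⊗_S P` with `P` a
projective left `S`-module. -/
def omegaProj (M : ModuleCat.{u} R) : Prop :=
  ∃ P : ModuleCat.{u} S, Module.Projective S P ∧
    Nonempty (M ≅ ModuleCat.of R (BiTensor R S ω P))

end Bass

section Dimension

variable {R : Type u} [Ring R]

/-- An exact sequence `0 → M → X⁰ → ⋯ → Xⁿ → 0` with all `Xⁱ` in the class `𝒳`, recorded as a
cochain complex that vanishes in degrees above `n`. -/
structure Coresolution (𝒳 : ModuleCat.{u} R → Prop) (M : ModuleCat.{u} R) (n : ℕ) where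
  X : CochainComplex (ModuleCat.{u} R) ℕ
  ε : M ⟶ X.X 0
  mono : Mono ε
  comp_zero : ε ≫ X.d 0 1 = 0
  exact_zero : (ShortComplex.mk ε (X.d 0 1) comp_zero).Exact
  exact_succ : ∀ i, X.ExactAt (i + 1)
  mem : ∀ i ≤ n, 𝒳 (X.X i)
  isZero : ∀ i, n < i → IsZero (X.X i)

/-- The `𝒳`-injective dimension of `M`: the infimum of all `n` for which there is an
`𝒳`-coresolution `0 → M → X⁰ → ⋯ → Xⁿ → 0`, and `⊤` if there is none. -/
def injDim (𝒳 : ModuleCat.{u} R → Prop) (M : ModuleCat.{u} R) : ℕ∞ :=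
  ⨅ (n : ℕ) (_ : Nonempty (Coresolution 𝒳 M n)), (n : ℕ∞)

/-- `𝒳`-`id M ≤ n - 1`. For `n = 0` this says `𝒳`-`id M ≤ -1`, that is, `M = 0`. -/
def InjDimLESubOne (𝒳 : ModuleCat.{u} R → Prop) (M : ModuleCat.{u} R) : ℕ → Prop
  | 0 => IsZero M
  | n + 1 => injDim 𝒳 M ≤ n

/-- An injective resolution `0 → M → I⁰ → I¹ → ⋯` is minimal if every `Iⁱ` is an injective
envelope of the kernel of `Iⁱ → Iⁱ⁺¹` (which is `M` for `i = 0` and the image of `Iⁱ⁻¹ → Iⁱ` for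
`i ≥ 1`), i.e. if this kernel is an essential submodule of `Iⁱ`. -/
def IsMinimal {M : ModuleCat.{u} R} (I : InjectiveResolution M) : Prop :=
  ∀ (i : ℕ) (N : Submodule R (I.cocomplex.X i)),
    N ⊓ LinearMap.ker (I.cocomplex.d i (i + 1)).hom = ⊥ → N = ⊥

/-- The `m`-th cosyzygy of `M` with respect to an injective resolution: `M` itself for `m = 0`,
and the image of `Iᵐ⁻¹ → Iᵐ` for `m ≥ 1`. -/
def cosyzygy {M : ModuleCat.{u} R} (I : InjectiveResolution M) : ℕ → ModuleCat.{u} R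
  | 0 => M
  | m + 1 => ModuleCat.of R (LinearMap.range (I.cocomplex.d m (m + 1)).hom)

end Dimension

end

end BassDim

/-! The Bass class contains the injective modules (`bassClass_of_injective`) and the ω-projective
ones (`bassClass_tensor`). It is closed under extensions and under cokernels of monomorphisms
between its members, and it contains the kernel K of an epimorphism between members as soon as
Ext^1_R(ω, K) = 0. Given this, the theorem is dimension theory in the style of Auslander and
Buchweitz.

Since Ext^i_R(ω, -) kills the Bass class for i ≥ 1, dimension shifting bounds the nonzero Ext
degrees by the Bass dimension. Conversely, a module of finite Bass dimension with no positive Ext is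
itself in the class (`CoresLE.bassClass_of_ext`). Cosyzygies do not raise the Bass dimension
(`CoresLE.cosyzygy_step`) and their Ext groups are shifted Ext groups of M, so from degree n on they
are in the class. In turn coΩ^n in the class completes the injective terms before it to a
coresolution of length n. The two approximation sequences come from pullbacks and from
`bassClass.exists_generator`: each Bass module is a quotient of an ω-projective one with Bass
kernel.

The closure properties are proved by taking characters. The group (ω ⊗_S N)⁺ is Hom_S(N, ω⁺), so Tor
vanishing becomes vanishing of Ext_S(-, ω⁺), and bijectivity of θ becomes bijectivity of M⁺ →
Hom_S(M_*, ω⁺) (`bassClass_iff`). Only Ext sequences and the five lemma are then needed. -/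

namespace BassDim

noncomputable section

/-! ### Characters with values in ℚ/ℤ detect exactness -/

section Characters

variable {A B C : Type u} [AddCommGroup A] [AddCommGroup B] [AddCommGroup C]

/-- A character that vanishes on the kernel of `g` extends along `g`. -/
lemma exists_character_extension (g : B →+ C) (χ : B →+ AddCircle (1 : ℚ))
    (h : ∀ b, g b = 0 → χ b = 0) : ∃ ψ : C →+ AddCircle (1 : ℚ), ∀ b, ψ (g b) = χ b := by
  have hg := QuotientAddGroup.kerLift_injective g
  obtain ⟨ψ, hψ⟩ := CharacterModule.dual_surjective_of_injective
    (QuotientAddGroup.kerLift g).toIntLinearMap hg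
    (QuotientAddGroup.lift g.ker χ fun b hb => h b hb)
  refine ⟨ψ, fun b => ?_⟩
  exact DFunLike.congr_fun hψ (QuotientAddGroup.mk b)

/-- An element on which every character that vanishes on `H` vanishes lies in `H`. -/
lemma mem_of_forall_character (H : AddSubgroup B) (b : B)
    (h : ∀ χ : B →+ AddCircle (1 : ℚ), (∀ a ∈ H, χ a = 0) → χ b = 0) : b ∈ H := by
  rw [← QuotientAddGroup.eq_zero_iff]
  refine CharacterModule.eq_zero_of_character_apply fun c => ?_
  refine h (AddMonoidHom.comp (show B ⧸ H →+ AddCircle (1 : ℚ) from c)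
    (QuotientAddGroup.mk' H)) fun a ha => ?_
  have : QuotientAddGroup.mk' H a = 0 := (QuotientAddGroup.eq_zero_iff a).2 ha
  rw [AddMonoidHom.comp_apply, this, map_zero]

/-- ℚ/ℤ is an injective cogenerator: injectivity extends characters, and cogeneration separates an
element from the range of f. Neither direction needs g ∘ f = 0. -/
lemma exact_iff_characters (f : A →+ B) (g : B →+ C) :
    (∀ b, g b = 0 → ∃ a, f a = b) ↔
      ∀ χ : B →+ AddCircle (1 : ℚ), (∀ a, χ (f a) = 0) →
        ∃ ψ : C →+ AddCircle (1 : ℚ), ∀ b, ψ (g b) = χ b := by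
  constructor
  · intro h χ hχ
    refine exists_character_extension g χ fun b hb => ?_
    obtain ⟨a, rfl⟩ := h b hb
    exact hχ a
  · intro h b hb
    refine mem_of_forall_character f.range b fun χ hχ => ?_
    obtain ⟨ψ, hψ⟩ := h χ fun a => hχ _ ⟨a, rfl⟩
    rw [← hψ, hb, map_zero]

lemma bijective_iff_characters (f : A →+ B) :
    Function.Bijective f ↔
      Function.Bijective fun χ : B →+ AddCircle (1 : ℚ) => χ.comp f :=
  (CharacterModule.dual_bijective_iff_bijective (f := f.toIntLinearMap)).symm

end Characters

/-! ### Character modules and the adjunction (ω ⊗_S N)⁺ = Hom_S(N, ω⁺) -/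

section CharDual

variable (S A : Type u) [Ring S] [AddCommGroup A] [Module Sᵐᵒᵖ A]

/-- The character group `A⁺` of a right `S`-module, with its left `S`-module structure
`(s χ)(a) = χ(a s)`. -/
@[nolint unusedArguments]
def CharDual (_S A : Type u) [AddCommGroup A] : Type u := A →+ AddCircle (1 : ℚ)

instance : AddCommGroup (CharDual S A) :=
  inferInstanceAs (AddCommGroup (A →+ AddCircle (1 : ℚ)))

instance : FunLike (CharDual S A) A (AddCircle (1 : ℚ)) :=
  inferInstanceAs (FunLike (A →+ AddCircle (1 : ℚ)) A _)

instance : AddMonoidHomClass (CharDual S A) A (AddCircle (1 : ℚ)) :=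
  inferInstanceAs (AddMonoidHomClass (A →+ AddCircle (1 : ℚ)) A _)

variable {S A} in
@[ext] lemma CharDual.ext {χ ψ : CharDual S A} (h : ∀ a, χ a = ψ a) : χ = ψ :=
  AddMonoidHom.ext h

instance : Module S (CharDual S A) where
  smul s χ := AddMonoidHom.comp (show A →+ AddCircle (1 : ℚ) from χ)
    (DistribSMul.toAddMonoidHom A (MulOpposite.op s))
  one_smul χ := AddMonoidHom.ext fun x => congrArg χ (one_smul Sᵐᵒᵖ x)
  mul_smul s t χ := AddMonoidHom.ext fun x =>
    congrArg χ (mul_smul (MulOpposite.op t) (MulOpposite.op s) x)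
  smul_zero _ := rfl
  smul_add _ _ _ := rfl
  add_smul s t χ := AddMonoidHom.ext fun x =>
    (congrArg χ (add_smul (MulOpposite.op s) (MulOpposite.op t) x)).trans (map_add χ _ _)
  zero_smul χ := AddMonoidHom.ext fun x =>
    (congrArg χ (zero_smul Sᵐᵒᵖ x)).trans (map_zero χ)

lemma charDual_smul_apply (s : S) (χ : CharDual S A) (a : A) :
    (s • χ) a = χ (MulOpposite.op s • a) := rfl

variable {A} in
/-- The map `B⁺ → A⁺` induced by a map `A → B` of right `S`-modules. -/
def charDualMap {B : Type u} [AddCommGroup B] [Module Sᵐᵒᵖ B] (f : A →ₗ[Sᵐᵒᵖ] B) :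
    CharDual S B →ₗ[S] CharDual S A where
  toFun χ := AddMonoidHom.comp (show B →+ AddCircle (1 : ℚ) from χ) f.toAddMonoidHom
  map_add' _ _ := rfl
  map_smul' s χ := AddMonoidHom.ext fun x => congrArg χ (map_smul f (MulOpposite.op s) x).symm

end CharDual

section TensorCharacters

open scoped TensorProduct

variable (R S ω : Type u) [Ring R] [Ring S] [AddCommGroup ω] [Module R ω] [Module Sᵐᵒᵖ ω]
  [SMulCommClass R Sᵐᵒᵖ ω]

/-- The map `(ω ⊗_S N)⁺ → Hom_S(N, ω⁺)`. -/
def tensorChar (N : Type u) [AddCommGroup N] [Module S N]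
    (χ : BiTensor R S ω N →+ AddCircle (1 : ℚ)) : N →ₗ[S] CharDual S ω where
  toFun n :=
    ({ toFun := fun x => χ (Submodule.Quotient.mk (x ⊗ₜ n))
       map_zero' := by simp
       map_add' := fun x y => by
        rw [TensorProduct.add_tmul, Submodule.Quotient.mk_add, map_add] } :
      ω →+ AddCircle (1 : ℚ))
  map_add' n m := AddMonoidHom.ext fun x =>
    (congrArg χ (by rw [TensorProduct.tmul_add, Submodule.Quotient.mk_add])).trans (map_add χ _ _)
  map_smul' s n := AddMonoidHom.ext fun x => congrArg χ <| by
    exact ((Submodule.Quotient.eq (balanced R S ω N)).2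
      (Submodule.subset_span ⟨x, s, n, rfl⟩)).symm

variable {R S ω} in
lemma tensor_addHom_ext {N : Type u} [AddCommGroup N] [Module S N] {L : Type*} [AddCommGroup L]
    {g h : BiTensor R S ω N →+ L}
    (H : ∀ (x : ω) (n : N), g (Submodule.Quotient.mk (x ⊗ₜ n)) =
      h (Submodule.Quotient.mk (x ⊗ₜ n))) : g = h := by
  refine AddMonoidHom.ext fun t => ?_
  induction t using Submodule.Quotient.induction_on with
  | _ t =>
    induction t using TensorProduct.induction_on with
    | zero => simp
    | tmul x n => exact H x n
    | add a b ha hb => rw [Submodule.Quotient.mk_add, map_add, map_add, ha, hb]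

lemma tensorChar_bijective (N : Type u) [AddCommGroup N] [Module S N] :
    Function.Bijective (tensorChar R S ω N) := by
  constructor
  · intro χ ψ h
    refine tensor_addHom_ext fun x n => ?_
    exact DFunLike.congr_fun (DFunLike.congr_fun h n) x
  · intro u
    let χ₀ : ω ⊗[ℤ] N →+ AddCircle (1 : ℚ) := TensorProduct.liftAddHom
      { toFun := fun x =>
          { toFun := fun n => u n x
            map_zero' := by rw [map_zero]; rfl
            map_add' := fun n m => by rw [map_add]; rfl }
        map_zero' := AddMonoidHom.ext fun n => map_zero (u n)
        map_add' := fun x y => AddMonoidHom.ext fun n => map_add (u n) x y }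
      (fun z x n => by
        change u n (z • x) = u (z • n) x
        rw [map_zsmul, map_zsmul]; rfl)
    -- `balanced` is an R-span while χ₀ is only additive, so the induction must carry all
    -- R-multiples of t.
    have hχ₀ : ∀ t ∈ balanced R S ω N, ∀ r : R, χ₀ (r • t) = 0 := by
      intro t ht
      induction ht using Submodule.span_induction with
      | mem t ht =>
        obtain ⟨x, s, n, rfl⟩ := ht
        intro r
        have : u n (r • (MulOpposite.op s • x)) - u (s • n) (r • x) = 0 := by
          rw [u.map_smul, charDual_smul_apply, smul_comm, sub_self]
        rw [smul_sub, TensorProduct.smul_tmul', TensorProduct.smul_tmul', map_sub]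
        exact this
      | zero => intro r; rw [smul_zero, map_zero]
      | add a b _ _ ha hb => intro r; rw [smul_add, map_add, ha, hb, add_zero]
      | smul a t _ ht => intro r; rw [smul_smul]; exact ht _
    refine ⟨QuotientAddGroup.lift (balanced R S ω N).toAddSubgroup χ₀ fun t ht => ?_, ?_⟩
    · have := hχ₀ t ht 1
      rwa [one_smul] at this
    · refine LinearMap.ext fun n => CharDual.ext fun x => ?_
      rfl

lemma tensorChar_tensorMap {N N' : Type u} [AddCommGroup N] [Module S N] [AddCommGroup N']
    [Module S N'] (f : N →ₗ[S] N') (χ : BiTensor R S ω N' →+ AddCircle (1 : ℚ)) :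
    tensorChar R S ω N (χ.comp (tensorMap R ω f).toAddMonoidHom) =
      (tensorChar R S ω N' χ).comp f := rfl

end TensorCharacters

/-! ### Ext and Tor vanishing as exactness conditions on elements -/

section ExtVanishing

variable {A : Type u} [Ring A] {X Y : ModuleCat.{u} A}

lemma ext_succ_subsingleton_iff (P : ProjectiveResolution X) (i : ℕ) :
    Subsingleton (Abelian.Ext X Y (i + 1)) ↔
      ∀ f : P.complex.X (i + 1) ⟶ Y, P.complex.d (i + 2) (i + 1) ≫ f = 0 →
        ∃ g : P.complex.X i ⟶ Y, P.complex.d (i + 1) i ≫ g = f := by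
  constructor
  · intro h f hf
    exact (P.extMk_eq_zero_iff f (i + 2) rfl hf i rfl).1 (Subsingleton.elim _ _)
  · intro h
    refine subsingleton_of_forall_eq 0 fun e => ?_
    obtain ⟨f, hf, rfl⟩ := P.extMk_surjective e (i + 2) rfl
    exact (P.extMk_eq_zero_iff f (i + 2) rfl hf i rfl).2 (h f hf)

lemma ext_succ_subsingleton_iff_injective (I : InjectiveResolution Y) (i : ℕ) :
    Subsingleton (Abelian.Ext X Y (i + 1)) ↔
      ∀ f : X ⟶ I.cocomplex.X (i + 1), f ≫ I.cocomplex.d (i + 1) (i + 2) = 0 →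
        ∃ g : X ⟶ I.cocomplex.X i, g ≫ I.cocomplex.d i (i + 1) = f := by
  constructor
  · intro h f hf
    exact (I.extMk_eq_zero_iff f (i + 2) rfl hf i rfl).1 (Subsingleton.elim _ _)
  · intro h
    refine subsingleton_of_forall_eq 0 fun e => ?_
    obtain ⟨f, hf, rfl⟩ := I.extMk_surjective e (i + 2) rfl
    exact (I.extMk_eq_zero_iff f (i + 2) rfl hf i rfl).2 (h f hf)

lemma exactAt_succ_iff (K : ChainComplex (ModuleCat.{u} A) ℕ) (i : ℕ) :
    K.ExactAt (i + 1) ↔ ∀ x : K.X (i + 1), K.d (i + 1) i x = 0 →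
      ∃ y : K.X (i + 2), K.d (i + 2) (i + 1) y = x := by
  rw [K.exactAt_iff' (i + 2) (i + 1) i (by simp) (by simp), ShortComplex.moduleCat_exact_iff]
  rfl

lemma cochain_exactAt_succ_iff (K : CochainComplex (ModuleCat.{u} A) ℕ) (i : ℕ) :
    K.ExactAt (i + 1) ↔ ∀ x : K.X (i + 1), K.d (i + 1) (i + 2) x = 0 →
      ∃ y : K.X i, K.d i (i + 1) y = x := by
  rw [K.exactAt_iff' i (i + 1) (i + 2) (by simp) (by simp), ShortComplex.moduleCat_exact_iff]
  rfl

end ExtVanishing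

section Tor

variable (R S ω : Type u) [Ring R] [Ring S] [AddCommGroup ω] [Module R ω] [Module Sᵐᵒᵖ ω]
  [SMulCommClass R Sᵐᵒᵖ ω]

/-- `Tor_i^S(ω, N)` vanishes exactly when `Ext^i_S(N, ω⁺)` does. -/
lemma isZero_tor_succ_iff (N : ModuleCat.{u} S) (i : ℕ) :
    IsZero (tor R S ω (i + 1) N) ↔
      Subsingleton (Abelian.Ext N (ModuleCat.of S (CharDual S ω)) (i + 1)) := by
  let P := projectiveResolution N
  rw [ext_succ_subsingleton_iff P]
  let K := ((tensorFunctor R S ω).mapHomologicalComplex _).obj P.complex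
  have e : tor R S ω (i + 1) N ≅ K.homology (i + 1) :=
    P.isoLeftDerivedObj (tensorFunctor R S ω) (i + 1)
  rw [e.isZero_iff, ← HomologicalComplex.exactAt_iff_isZero_homology, exactAt_succ_iff]
  -- Exactness of ω ⊗_S P is tested on characters, and `tensorChar` identifies the dual complex with
  -- Hom_S(P, ω⁺), whose cohomology is Ext_S(N, ω⁺).
  refine Iff.trans (exact_iff_characters (K.d (i + 2) (i + 1)).hom.toAddMonoidHom
    (K.d (i + 1) i).hom.toAddMonoidHom) ?_
  constructor
  · intro h f hf
    obtain ⟨χ, hχ⟩ := (tensorChar_bijective R S ω _).2 f.hom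
    obtain ⟨ψ, hψ⟩ := h χ (DFunLike.congr_fun (f := χ.comp
      (tensorMap R ω (P.complex.d (i + 2) (i + 1)).hom).toAddMonoidHom) (g := 0) <| by
        apply (tensorChar_bijective R S ω _).1
        rw [tensorChar_tensorMap, hχ]
        exact congrArg ModuleCat.Hom.hom hf)
    refine ⟨ModuleCat.ofHom (tensorChar R S ω _ ψ), ModuleCat.hom_ext ?_⟩
    rw [← hχ]
    have : ψ.comp (tensorMap R ω (P.complex.d (i + 1) i).hom).toAddMonoidHom = χ :=
      AddMonoidHom.ext hψ
    rw [← this]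
    rfl
  · intro h χ hχ
    obtain ⟨g, hg⟩ := h (ModuleCat.ofHom (tensorChar R S ω _ χ)) <| ModuleCat.hom_ext <| by
      have : χ.comp (tensorMap R ω (P.complex.d (i + 2) (i + 1)).hom).toAddMonoidHom = 0 :=
        AddMonoidHom.ext hχ
      have h2 := tensorChar_tensorMap R S ω (P.complex.d (i + 2) (i + 1)).hom χ
      exact h2.symm.trans (congrArg (tensorChar R S ω _) this)
    obtain ⟨ψ, hψ⟩ := (tensorChar_bijective R S ω _).2 g.hom
    refine ⟨ψ, DFunLike.congr_fun (f := ψ.comp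
      (tensorMap R ω (P.complex.d (i + 1) i).hom).toAddMonoidHom) (g := χ) ?_⟩
    apply (tensorChar_bijective R S ω _).1
    rw [tensorChar_tensorMap, hψ]
    exact congrArg ModuleCat.Hom.hom hg

end Tor

/-! ### Five lemma and long exact Ext sequences (primed names: contravariant) -/

section FiveLemma

variable {A₁ A₂ A₃ B₁ B₂ B₃ : Type*} [AddCommGroup A₁] [AddCommGroup A₂] [AddCommGroup A₃]
  [AddCommGroup B₁] [AddCommGroup B₂] [AddCommGroup B₃]
  {f : A₁ →+ A₂} {g : A₂ →+ A₃} {f' : B₁ →+ B₂} {g' : B₂ →+ B₃}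
  {a₁ : A₁ →+ B₁} {a₂ : A₂ →+ B₂} {a₃ : A₃ →+ B₃}

/-- The hypotheses are cut to what the applications provide: the top row consists of character
groups and is fully exact, while the bottom row Hom_S(-, ω⁺) is in general only left exact. -/
lemma bijective_middle (hf' : Function.Injective f') (h : Function.Exact f g)
    (hg : Function.Surjective g) (h' : Function.Exact f' g')
    (c₁ : ∀ x, a₂ (f x) = f' (a₁ x)) (c₂ : ∀ x, a₃ (g x) = g' (a₂ x))
    (b₁ : Function.Bijective a₁) (b₃ : Function.Bijective a₃) : Function.Bijective a₂ := by
  constructor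
  · refine (injective_iff_map_eq_zero _).2 fun x hx => ?_
    have : g x = 0 := b₃.1 (by rw [c₂, hx, map_zero, map_zero])
    obtain ⟨w, rfl⟩ := (h x).1 this
    have : w = 0 := b₁.1 (hf' (by rw [← c₁, hx, map_zero, map_zero]))
    rw [this, map_zero]
  · intro y
    obtain ⟨z, hz⟩ := b₃.2 (g' y)
    obtain ⟨x, rfl⟩ := hg z
    obtain ⟨v, hv⟩ := (h' (y - a₂ x)).1 (by rw [map_sub, ← c₂, hz, sub_self])
    obtain ⟨w, rfl⟩ := b₁.2 v
    exact ⟨f w + x, by rw [map_add, c₁, hv, sub_add_cancel]⟩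

lemma bijective_right (h : Function.Exact f g) (hg : Function.Surjective g)
    (h' : Function.Exact f' g') (hg' : Function.Surjective g')
    (c₁ : ∀ x, a₂ (f x) = f' (a₁ x)) (c₂ : ∀ x, a₃ (g x) = g' (a₂ x))
    (b₁ : Function.Bijective a₁) (b₂ : Function.Bijective a₂) : Function.Bijective a₃ := by
  constructor
  · refine (injective_iff_map_eq_zero _).2 fun z hz => ?_
    obtain ⟨x, rfl⟩ := hg z
    obtain ⟨v, hv⟩ := (h' (a₂ x)).1 (by rw [← c₂, hz])
    obtain ⟨w, rfl⟩ := b₁.2 v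
    have : f w = x := b₂.1 (by rw [c₁, hv])
    exact (h x).2 ⟨w, this⟩
  · intro y
    obtain ⟨z, rfl⟩ := hg' y
    obtain ⟨x, rfl⟩ := b₂.2 z
    exact ⟨g x, c₂ x⟩

lemma bijective_left (hf : Function.Injective f) (h : Function.Exact f g)
    (hf' : Function.Injective f') (h' : Function.Exact f' g')
    (c₁ : ∀ x, a₂ (f x) = f' (a₁ x)) (c₂ : ∀ x, a₃ (g x) = g' (a₂ x))
    (b₂ : Function.Bijective a₂) (b₃ : Function.Bijective a₃) : Function.Bijective a₁ := by
  constructor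
  · refine (injective_iff_map_eq_zero _).2 fun w hw => hf (b₂.1 ?_)
    rw [c₁, hw, map_zero, map_zero, map_zero]
  · intro y
    obtain ⟨x, hx⟩ := b₂.2 (f' y)
    have : g x = 0 := b₃.1 (by rw [c₂, hx, map_zero]; exact (h' _).2 ⟨y, rfl⟩)
    obtain ⟨w, rfl⟩ := (h x).1 this
    exact ⟨w, hf' (by rw [← c₁, hx])⟩

end FiveLemma

section ShortExact

variable {A : Type u} [Ring A]

/-- `0 → K → X → Y → 0` is a short exact sequence of modules. -/
structure IsShortExact {K X Y : ModuleCat.{u} A} (f : K ⟶ X) (g : X ⟶ Y) : Prop where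
  injective : Function.Injective f
  exact : Function.Exact f g
  surjective : Function.Surjective g

variable {K X Y : ModuleCat.{u} A} {f : K ⟶ X} {g : X ⟶ Y}

namespace IsShortExact

lemma comp_eq_zero (h : IsShortExact f g) : f ≫ g = 0 :=
  ModuleCat.hom_ext (LinearMap.ext fun x => h.exact.apply_apply_eq_zero x)

lemma shortExact (h : IsShortExact f g) :
    (ShortComplex.mk f g h.comp_eq_zero).ShortExact :=
  ModuleCat.shortComplex_shortExact _ h.exact h.injective h.surjective

lemma of_shortExact {w : f ≫ g = 0} (h : (ShortComplex.mk f g w).ShortExact) :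
    IsShortExact f g where
  injective := h.moduleCat_injective_f
  exact := (ShortComplex.ShortExact.moduleCat_exact_iff_function_exact _).1 h.exact
  surjective := h.moduleCat_surjective_g

lemma map_eq_zero (h : IsShortExact f g) (x : K) : g (f x) = 0 :=
  h.exact.apply_apply_eq_zero x

variable {T : ModuleCat.{u} A}

lemma ext_middle (h : IsShortExact f g) {n : ℕ} (h₁ : Subsingleton (Abelian.Ext T K n))
    (h₃ : Subsingleton (Abelian.Ext T Y n)) : Subsingleton (Abelian.Ext T X n) := by
  refine subsingleton_of_forall_eq 0 fun e => ?_
  obtain ⟨x, rfl⟩ := Abelian.Ext.covariant_sequence_exact₂ T h.shortExact e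
    (Subsingleton.elim _ _)
  rw [Subsingleton.elim x 0, Abelian.Ext.zero_comp]

lemma ext_right (h : IsShortExact f g) {n : ℕ} (h₂ : Subsingleton (Abelian.Ext T X n))
    (h₁ : Subsingleton (Abelian.Ext T K (n + 1))) : Subsingleton (Abelian.Ext T Y n) := by
  refine subsingleton_of_forall_eq 0 fun e => ?_
  obtain ⟨x, rfl⟩ := Abelian.Ext.covariant_sequence_exact₃ T h.shortExact e rfl
    (Subsingleton.elim _ _)
  rw [Subsingleton.elim x 0, Abelian.Ext.zero_comp]

lemma ext_left (h : IsShortExact f g) {n : ℕ} (h₃ : Subsingleton (Abelian.Ext T Y n))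
    (h₂ : Subsingleton (Abelian.Ext T X (n + 1))) : Subsingleton (Abelian.Ext T K (n + 1)) := by
  refine subsingleton_of_forall_eq 0 fun e => ?_
  obtain ⟨x, rfl⟩ := Abelian.Ext.covariant_sequence_exact₁ T h.shortExact e
    (Subsingleton.elim _ _) rfl
  rw [Subsingleton.elim x 0, Abelian.Ext.zero_comp]

lemma ext_middle' (h : IsShortExact f g) {n : ℕ} (h₁ : Subsingleton (Abelian.Ext K T n))
    (h₃ : Subsingleton (Abelian.Ext Y T n)) : Subsingleton (Abelian.Ext X T n) := by
  refine subsingleton_of_forall_eq 0 fun e => ?_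
  obtain ⟨x, rfl⟩ := Abelian.Ext.contravariant_sequence_exact₂ h.shortExact T e
    (Subsingleton.elim _ _)
  rw [Subsingleton.elim x 0, Abelian.Ext.comp_zero]

lemma ext_left' (h : IsShortExact f g) {n : ℕ} (h₂ : Subsingleton (Abelian.Ext X T n))
    (h₃ : Subsingleton (Abelian.Ext Y T (n + 1))) : Subsingleton (Abelian.Ext K T n) := by
  refine subsingleton_of_forall_eq 0 fun e => ?_
  obtain ⟨x, rfl⟩ := Abelian.Ext.contravariant_sequence_exact₁ h.shortExact T e
    (Nat.add_comm 1 n) (Subsingleton.elim _ _)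
  rw [Subsingleton.elim x 0, Abelian.Ext.comp_zero]

lemma ext_right' (h : IsShortExact f g) {n : ℕ} (h₁ : Subsingleton (Abelian.Ext K T n))
    (h₂ : Subsingleton (Abelian.Ext X T (n + 1))) : Subsingleton (Abelian.Ext Y T (n + 1)) := by
  refine subsingleton_of_forall_eq 0 fun e => ?_
  obtain ⟨x, rfl⟩ := Abelian.Ext.contravariant_sequence_exact₃ h.shortExact T e
    (Subsingleton.elim _ _) (Nat.add_comm 1 n)
  rw [Subsingleton.elim x 0, Abelian.Ext.comp_zero]

/-- If every map from `K` extends to `X`, one vanishing condition suffices in degree one. -/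
lemma ext_one_right' (h : IsShortExact f g) (h₁ : ∀ u : K ⟶ T, ∃ v : X ⟶ T, f ≫ v = u)
    (h₂ : Subsingleton (Abelian.Ext X T 1)) : Subsingleton (Abelian.Ext Y T 1) := by
  refine subsingleton_of_forall_eq 0 fun e => ?_
  obtain ⟨x, rfl⟩ := Abelian.Ext.contravariant_sequence_exact₃ h.shortExact T e
    (Subsingleton.elim _ _) (rfl : 1 + 0 = 1)
  obtain ⟨u, rfl⟩ := Abelian.Ext.mk₀_bijective _ _ |>.2 x
  obtain ⟨v, rfl⟩ := h₁ u
  -- The class is the image of f ≫ v under the connecting map, and the extension class composed with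
  -- f is zero.
  rw [← Abelian.Ext.mk₀_comp_mk₀, ← Abelian.Ext.comp_assoc_of_second_deg_zero]
  exact (congrArg (fun t => Abelian.Ext.comp t (Abelian.Ext.mk₀ v) _)
    h.shortExact.extClass_comp).trans (Abelian.Ext.zero_comp _ _ _ _ _)

lemma exists_extension (h : IsShortExact f g) (h₃ : Subsingleton (Abelian.Ext Y T 1))
    (u : K ⟶ T) : ∃ v : X ⟶ T, f ≫ v = u := by
  obtain ⟨x, hx⟩ := Abelian.Ext.contravariant_sequence_exact₁ h.shortExact T (Abelian.Ext.mk₀ u)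
    (rfl : 1 + 0 = 1) (Subsingleton.elim _ _)
  obtain ⟨v, rfl⟩ := Abelian.Ext.mk₀_bijective _ _ |>.2 x
  refine ⟨v, (Abelian.Ext.mk₀_bijective _ _).1 ?_⟩
  rw [← hx, Abelian.Ext.mk₀_comp_mk₀]

lemma exists_lift (h : IsShortExact f g) (h₁ : Subsingleton (Abelian.Ext T K 1))
    (u : T ⟶ Y) : ∃ v : T ⟶ X, v ≫ g = u := by
  obtain ⟨x, hx⟩ := Abelian.Ext.covariant_sequence_exact₃ T h.shortExact (Abelian.Ext.mk₀ u)
    (rfl : 0 + 1 = 1) (Subsingleton.elim _ _)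
  obtain ⟨v, rfl⟩ := Abelian.Ext.mk₀_bijective _ _ |>.2 x
  refine ⟨v, (Abelian.Ext.mk₀_bijective _ _).1 ?_⟩
  rw [← hx, Abelian.Ext.mk₀_comp_mk₀]

/-- Lifting all maps `T → Y` and vanishing for `X` give vanishing for `K` in degree one. -/
lemma ext_one_left (h : IsShortExact f g) (h₁ : ∀ u : T ⟶ Y, ∃ v : T ⟶ X, v ≫ g = u)
    (h₂ : Subsingleton (Abelian.Ext T X 1)) : Subsingleton (Abelian.Ext T K 1) := by
  refine subsingleton_of_forall_eq 0 fun e => ?_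
  obtain ⟨x, rfl⟩ := Abelian.Ext.covariant_sequence_exact₁ T h.shortExact e
    (Subsingleton.elim _ _) (rfl : 0 + 1 = 1)
  obtain ⟨u, rfl⟩ := Abelian.Ext.mk₀_bijective _ _ |>.2 x
  obtain ⟨v, rfl⟩ := h₁ u
  rw [← Abelian.Ext.mk₀_comp_mk₀, Abelian.Ext.comp_assoc_of_second_deg_zero]
  exact (congrArg (fun t => Abelian.Ext.comp (Abelian.Ext.mk₀ v) t _)
    h.shortExact.comp_extClass).trans (Abelian.Ext.comp_zero _ _ _ _ _)

end IsShortExact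

end ShortExact

/-! ### The Bass class in terms of characters, and its closure properties -/

section BassCharacters

variable (R S ω : Type u) [Ring R] [Ring S] [AddCommGroup ω] [Module R ω] [Module Sᵐᵒᵖ ω]
  [SMulCommClass R Sᵐᵒᵖ ω]

/-- The map `f_* : M_* → N_*` induced by `f : M → N`. -/
def starMap {M N : Type u} [AddCommGroup M] [Module R M] [AddCommGroup N] [Module R N]
    (f : M →ₗ[R] N) : Star R ω S M →ₗ[S] Star R ω S N where
  toFun h := LinearMap.comp f (show ω →ₗ[R] M from h)
  map_add' h k := LinearMap.ext fun x => map_add f (h x) (k x)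
  map_smul' _ _ := rfl

/-- `M_*` as an object of `Mod S`. -/
abbrev starObj (M : ModuleCat.{u} R) : ModuleCat.{u} S := ModuleCat.of S (Star R ω S M)

/-- `ω⁺` as an object of `Mod S`. -/
abbrev dualObj : ModuleCat.{u} S := ModuleCat.of S (CharDual S ω)

/-- The map `M⁺ → Hom_S(M_*, ω⁺)`, `χ ↦ (f ↦ χ ∘ f)`. -/
def evalChar (M : Type u) [AddCommGroup M] [Module R M] :
    (M →+ AddCircle (1 : ℚ)) →+ (Star R ω S M →ₗ[S] CharDual S ω) where
  toFun χ :=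
    { toFun := fun f => χ.comp (LinearMap.toAddMonoidHom (show ω →ₗ[R] M from f))
      map_add' := fun f g => AddMonoidHom.ext fun x => map_add χ (f x) (g x)
      map_smul' := fun _ _ => rfl }
  map_zero' := rfl
  map_add' _ _ := rfl

/-- `evalChar` is the character dual of θ followed by the adjunction isomorphism, and dualising
preserves and reflects bijections. -/
lemma theta_bijective_iff (M : Type u) [AddCommGroup M] [Module R M] :
    Function.Bijective (theta R S ω M) ↔ Function.Bijective (evalChar R S ω M) := by
  have h : evalChar R S ω M = tensorChar R S ω (Star R ω S M) ∘
      fun χ : M →+ AddCircle (1 : ℚ) => χ.comp (theta R S ω M).toAddMonoidHom := rfl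
  rw [h, (tensorChar_bijective R S ω _).of_comp_iff']
  exact bijective_iff_characters (theta R S ω M).toAddMonoidHom

lemma bassClass_iff (M : ModuleCat.{u} R) :
    bassClass R S ω M ↔
      (∀ i : ℕ, Subsingleton (Abelian.Ext (ModuleCat.of R ω) M (i + 1))) ∧
      (∀ i : ℕ, Subsingleton (Abelian.Ext (starObj R S ω M) (dualObj S ω) (i + 1))) ∧
      Function.Bijective (evalChar R S ω M) := by
  constructor
  · rintro ⟨h₁, h₂, h₃⟩
    exact ⟨fun i => h₁ _ (Nat.le_add_left 1 i),
      fun i => (isZero_tor_succ_iff R S ω _ i).1 (h₂ _ (Nat.le_add_left 1 i)),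
      (theta_bijective_iff R S ω M).1 h₃⟩
  · rintro ⟨h₁, h₂, h₃⟩
    refine ⟨fun i hi => ?_, fun i hi => ?_, (theta_bijective_iff R S ω M).2 h₃⟩
    · obtain ⟨j, rfl⟩ := Nat.exists_eq_add_of_le' hi
      exact h₁ j
    · obtain ⟨j, rfl⟩ := Nat.exists_eq_add_of_le' hi
      exact (isZero_tor_succ_iff R S ω _ j).2 (h₂ j)

variable {R} {K X Y : ModuleCat.{u} R} {f : K ⟶ X} {g : X ⟶ Y}

lemma IsShortExact.star (h : IsShortExact f g)
    (h₁ : ∀ u : ModuleCat.of R ω ⟶ Y, ∃ v : ModuleCat.of R ω ⟶ X, v ≫ g = u) :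
    IsShortExact (K := starObj R S ω K) (X := starObj R S ω X) (Y := starObj R S ω Y)
      (ModuleCat.ofHom (starMap R S ω f.hom)) (ModuleCat.ofHom (starMap R S ω g.hom)) where
  injective a b hab := LinearMap.ext fun x => h.injective (DFunLike.congr_fun hab x)
  exact b := by
    constructor
    · intro hb
      have hb' : ∀ x : ω, ∃ k : K, f k = b x := fun x => (h.exact _).1 (DFunLike.congr_fun hb x)
      choose k hk using hb'
      refine ⟨({ toFun := k
                 map_add' := fun x y => h.injective ?_
                 map_smul' := fun r x => h.injective ?_ } : ω →ₗ[R] K), LinearMap.ext hk⟩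
      · rw [map_add, hk, hk, hk]; exact map_add (show ω →ₗ[R] X from b) x y
      · rw [RingHom.id_apply, map_smul, hk, hk]; exact map_smul (show ω →ₗ[R] X from b) r x
    · rintro ⟨a, rfl⟩
      exact LinearMap.ext fun x => h.map_eq_zero (a x)
  surjective u := by
    obtain ⟨v, hv⟩ := h₁ (ModuleCat.ofHom (show ω →ₗ[R] Y from u))
    exact ⟨v.hom, congrArg ModuleCat.Hom.hom hv⟩

/-- Precomposition as a map of additive groups. -/
def precompHom {N N' T : Type u} [AddCommGroup N] [Module S N] [AddCommGroup N'] [Module S N']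
    [AddCommGroup T] [Module S T] (f : N →ₗ[S] N') : (N' →ₗ[S] T) →+ (N →ₗ[S] T) where
  toFun u := u.comp f
  map_zero' := rfl
  map_add' _ _ := rfl

lemma IsShortExact.precompHom_exact {N₁ N₂ N₃ : ModuleCat.{u} S} {p : N₁ ⟶ N₂} {q : N₂ ⟶ N₃}
    (h : IsShortExact p q) (T : ModuleCat.{u} S) :
    Function.Injective (precompHom S (T := T) q.hom) ∧
      Function.Exact (precompHom S (T := T) q.hom) (precompHom S (T := T) p.hom) := by
  constructor
  · intro u v huv
    refine LinearMap.ext fun x => ?_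
    obtain ⟨y, rfl⟩ := h.surjective x
    exact DFunLike.congr_fun huv y
  · intro u
    constructor
    · intro hu
      refine ⟨(h.shortExact.gIsCokernel.desc (CokernelCofork.ofπ (ModuleCat.ofHom u)
        (ModuleCat.hom_ext hu))).hom, ?_⟩
      exact congrArg ModuleCat.Hom.hom (h.shortExact.gIsCokernel.fac (CokernelCofork.ofπ
        (ModuleCat.ofHom u) (ModuleCat.hom_ext hu)) WalkingParallelPair.one)
    · rintro ⟨v, rfl⟩
      exact LinearMap.ext fun x =>
        (congrArg v (h.map_eq_zero x)).trans (map_zero v)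

end BassCharacters

section TwoOfThree

variable {R S ω : Type u} [Ring R] [Ring S] [AddCommGroup ω] [Module R ω] [Module Sᵐᵒᵖ ω]
  [SMulCommClass R Sᵐᵒᵖ ω] {K X Y : ModuleCat.{u} R} {f : K ⟶ X} {g : X ⟶ Y}

/-- Precomposition of characters. -/
def precompChar {A B : Type u} [AddCommGroup A] [AddCommGroup B] (f : A →+ B) :
    (B →+ AddCircle (1 : ℚ)) →+ (A →+ AddCircle (1 : ℚ)) where
  toFun χ := χ.comp f
  map_zero' := rfl
  map_add' _ _ := rfl

lemma IsShortExact.precompChar_exact (h : IsShortExact f g) :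
    Function.Injective (precompChar g.hom.toAddMonoidHom) ∧
      Function.Exact (precompChar g.hom.toAddMonoidHom) (precompChar f.hom.toAddMonoidHom) ∧
      Function.Surjective (precompChar f.hom.toAddMonoidHom) := by
  refine ⟨fun χ ψ e => AddMonoidHom.ext fun y => ?_, fun χ => ⟨fun e => ?_, ?_⟩, fun χ => ?_⟩
  · obtain ⟨x, rfl⟩ := h.surjective y
    exact DFunLike.congr_fun e x
  · obtain ⟨ψ, hψ⟩ := exists_character_extension g.hom.toAddMonoidHom χ fun b hb => by
      obtain ⟨a, rfl⟩ := (h.exact b).1 hb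
      exact DFunLike.congr_fun e a
    exact ⟨ψ, AddMonoidHom.ext hψ⟩
  · rintro ⟨ψ, rfl⟩
    exact AddMonoidHom.ext fun x => (congrArg ψ (h.map_eq_zero x)).trans (map_zero ψ)
  · obtain ⟨ψ, hψ⟩ := exists_character_extension f.hom.toAddMonoidHom χ fun b hb => by
      rw [h.injective (hb.trans (map_zero f.hom).symm), map_zero]
    exact ⟨ψ, AddMonoidHom.ext hψ⟩

/-- The Bass class is closed under extensions. -/
lemma bassClass.extension (h : IsShortExact f g) (hK : bassClass R S ω K)
    (hY : bassClass R S ω Y) : bassClass R S ω X := by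
  have hs := h.star S ω fun u => h.exists_lift (hK.ext_eq_zero 1 le_rfl) u
  rw [bassClass_iff] at hK hY ⊢
  refine ⟨fun i => h.ext_middle (hK.1 i) (hY.1 i), fun i => hs.ext_middle' (hK.2.1 i) (hY.2.1 i),
    ?_⟩
  have hc := h.precompChar_exact
  have hp := hs.precompHom_exact S (dualObj S ω)
  -- Both rows are contravariant, so Y stands on the left and K on the right.
  exact bijective_middle hp.1 hc.2.1 hc.2.2 hp.2 (fun _ => rfl) (fun _ => rfl) hY.2.2 hK.2.2

/-- The Bass class is closed under kernels of epimorphisms that stay epimorphic under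
`Hom_R(ω, -)`. -/
lemma bassClass.kernel (h : IsShortExact f g)
    (h₁ : Subsingleton (Abelian.Ext (ModuleCat.of R ω) K 1))
    (hX : bassClass R S ω X) (hY : bassClass R S ω Y) : bassClass R S ω K := by
  have hs := h.star S ω fun u => h.exists_lift h₁ u
  rw [bassClass_iff] at hX hY ⊢
  refine ⟨fun i => ?_, fun i => hs.ext_left' (hX.2.1 i) (hY.2.1 (i + 1)), ?_⟩
  · cases i with
    | zero => exact h₁
    | succ i => exact h.ext_left (hY.1 i) (hX.1 (i + 1))
  have hc := h.precompChar_exact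
  have hp := hs.precompHom_exact S (dualObj S ω)
  refine bijective_right hc.2.1 hc.2.2 hp.2 (fun u => ?_) (fun _ => rfl) (fun _ => rfl)
    hY.2.2 hX.2.2
  -- The bottom row must end in a surjection: the obstruction to extending K_* → ω⁺ to X_* lies in
  -- Ext^1_S(Y_*, ω⁺) = 0.
  obtain ⟨v, hv⟩ := hs.exists_extension (hY.2.1 0) (ModuleCat.ofHom u)
  exact ⟨v.hom, congrArg ModuleCat.Hom.hom hv⟩

/-- The Bass class is closed under cokernels of monomorphisms. -/
lemma bassClass.cokernel (h : IsShortExact f g)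
    (hK : bassClass R S ω K) (hX : bassClass R S ω X) : bassClass R S ω Y := by
  have hs := h.star S ω fun u => h.exists_lift (hK.ext_eq_zero 1 le_rfl) u
  rw [bassClass_iff] at hK hX ⊢
  have hc := h.precompChar_exact
  have hp := hs.precompHom_exact S (dualObj S ω)
  refine ⟨fun i => h.ext_right (hX.1 i) (hK.1 (i + 1)), fun i => ?_,
    bijective_left hc.1 hc.2.1 hp.1 hp.2 (fun _ => rfl) (fun _ => rfl) hX.2.2 hK.2.2⟩
  cases i with
  | zero =>
    -- In degree one, maps K_* → ω⁺ have to extend to X_*. Each of them is given by a character of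
    -- K, and that character extends to X.
    refine hs.ext_one_right' (fun u => ?_) (hX.2.1 0)
    obtain ⟨χ, hχ⟩ := hK.2.2.2 u.hom
    obtain ⟨ψ, rfl⟩ := hc.2.2 χ
    exact ⟨ModuleCat.ofHom (evalChar R S ω X ψ), ModuleCat.hom_ext hχ⟩
  | succ i => exact hs.ext_right' (hK.2.1 i) (hX.2.1 (i + 1))

end TwoOfThree

/-! ### Injective resolutions and duals of finitely generated projectives -/

section Resolution

variable {A : Type u} [Ring A]

/-- An injective resolution from a cochain complex of injective modules with exactness checked on
elements. -/
def injectiveResolutionOfExact {M : ModuleCat.{u} A} (C : CochainComplex (ModuleCat.{u} A) ℕ)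
    (hC : ∀ i, Injective (C.X i)) (ε : M ⟶ C.X 0) (hε : Function.Injective ε)
    (hz : ∀ x : C.X 0, C.d 0 1 x = 0 ↔ ∃ m, ε m = x) (hs : ∀ i, C.ExactAt (i + 1)) :
    InjectiveResolution M where
  cocomplex := C
  injective := hC
  hasHomology _ := inferInstance
  ι := (CochainComplex.fromSingle₀Equiv _ _).symm
    ⟨ε, ModuleCat.hom_ext (LinearMap.ext fun m => (hz _).2 ⟨m, rfl⟩)⟩
  quasiIso := ⟨fun n => by
    have : Mono ε := (ModuleCat.mono_iff_injective _).2 hε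
    cases n
    · rw [CochainComplex.quasiIsoAt₀_iff, ShortComplex.quasiIso_iff_of_zeros]
      · refine (ShortComplex.exact_and_mono_f_iff_of_iso (S₂ := ShortComplex.mk ε (C.d 0 1)
          (ModuleCat.hom_ext (LinearMap.ext fun m => (hz _).2 ⟨m, rfl⟩))) ?_).2
          ⟨(ShortComplex.moduleCat_exact_iff _).2 fun x hx => (hz x).1 hx, by dsimp; infer_instance⟩
        exact ShortComplex.isoMk (Iso.refl _) (Iso.refl _) (Iso.refl _)
          (by simp; exact (Category.id_comp ε).trans (Category.comp_id ε).symm)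
          ((Category.id_comp _).trans (Category.comp_id _).symm)
      all_goals first | rfl | exact C.shape _ _ (by simp)
    · rw [quasiIsoAt_iff_exactAt]
      · exact hs _
      · apply CochainComplex.exactAt_succ_single_obj⟩

end Resolution

section DualBasis

lemma exists_dual_basis (A P : Type u) [Ring A] [AddCommGroup P] [Module A P]
    [Module.Projective A P] [Module.Finite A P] :
    ∃ (n : ℕ) (b : Fin n → P) (φ : Fin n → P →ₗ[A] A), ∀ p, ∑ k, φ k p • b k = p := by
  obtain ⟨n, f, g, -, -, h⟩ := Module.Finite.exists_comp_eq_id_of_projective A P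
  refine ⟨n, fun k => f (Pi.single k 1), fun k => (LinearMap.proj k).comp g, fun p => ?_⟩
  conv_rhs => rw [← LinearMap.id_apply (R := A) p, ← h, LinearMap.comp_apply,
    LinearMap.pi_apply_eq_sum_univ f (g p)]
  refine Finset.sum_congr rfl fun k _ => ?_
  refine congrArg (fun t => g p k • f t) (funext fun j => ?_)
  simp [Pi.single_apply, eq_comm]

/-- A map into an injective module that vanishes on the kernel of `g` extends along `g`. -/
lemma exists_linear_extension {R : Type u} [Ring R] {B C : Type u} [AddCommGroup B] [Module R B]
    [AddCommGroup C] [Module R C] (I : ModuleCat.{u} R) [Injective I] (g : B →ₗ[R] C)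
    (h : B →ₗ[R] I) (hg : ∀ b, g b = 0 → h b = 0) : ∃ h' : C →ₗ[R] I, ∀ b, h' (g b) = h b := by
  let j : ModuleCat.of R (B ⧸ LinearMap.ker g) ⟶ ModuleCat.of R C :=
    ModuleCat.ofHom ((LinearMap.ker g).liftQ g le_rfl)
  have : Mono j := by
    rw [ModuleCat.mono_iff_injective]
    exact LinearMap.ker_eq_bot.1 (Submodule.ker_liftQ_eq_bot _ _ _ le_rfl)
  let k : ModuleCat.of R (B ⧸ LinearMap.ker g) ⟶ I :=
    ModuleCat.ofHom ((LinearMap.ker g).liftQ h hg)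
  refine ⟨(Injective.factorThru k j).hom, fun b => ?_⟩
  exact ConcreteCategory.congr_hom (Injective.comp_factorThru k j) (Submodule.Quotient.mk b)

variable (S P : Type u) [Ring S] [AddCommGroup P] [Module Sᵐᵒᵖ P]

/-- The character module of a finitely generated projective right module is injective. -/
lemma injective_charDual [Module.Projective Sᵐᵒᵖ P] [Module.Finite Sᵐᵒᵖ P] :
    Injective (ModuleCat.of S (CharDual S P)) := by
  obtain ⟨n, b, φ, hb⟩ := exists_dual_basis Sᵐᵒᵖ P
  refine ⟨fun {X Y} u f hf => ?_⟩
  rw [ModuleCat.mono_iff_injective] at hf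
  -- By the dual basis, u x p = Σ (u (φ_k(p) x)) (b_k), so it is enough to extend the finitely many
  -- characters x ↦ (u x) (b_k) and to reassemble by this formula.
  have hχ : ∀ k, ∃ χ : Y →+ AddCircle (1 : ℚ), ∀ x : X, χ (f x) = (u x : CharDual S P) (b k) := by
    intro k
    exact exists_character_extension f.hom.toAddMonoidHom
      ({ toFun := fun x => (u x : CharDual S P) (b k)
         map_zero' := by rw [map_zero]; rfl
         map_add' := fun x y => by rw [map_add]; rfl } : X →+ AddCircle (1 : ℚ))
      fun x hx => by
        have : x = 0 := hf (hx.trans (map_zero f.hom).symm)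
        rw [this, map_zero]
  choose χ hχ using hχ
  let v : Y →ₗ[S] CharDual S P :=
    { toFun := fun y =>
        ({ toFun := fun p => ∑ k, χ k ((φ k p).unop • y)
           map_zero' := by simp
           map_add' := fun p q => by
            simp only [map_add, MulOpposite.unop_add, add_smul, Finset.sum_add_distrib] } :
          P →+ AddCircle (1 : ℚ))
      map_add' := fun y z => CharDual.ext fun p => by
        change ∑ k, χ k ((φ k p).unop • (y + z)) =
          ∑ k, χ k ((φ k p).unop • y) + ∑ k, χ k ((φ k p).unop • z)
        simp only [smul_add, map_add, Finset.sum_add_distrib]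
      map_smul' := fun s y => CharDual.ext fun p => by
        change ∑ k, χ k ((φ k p).unop • (s • y)) =
          ∑ k, χ k ((φ k (MulOpposite.op s • p)).unop • y)
        simp [smul_smul] }
  refine ⟨ModuleCat.ofHom v, ModuleCat.hom_ext (LinearMap.ext fun x => ?_)⟩
  refine AddMonoidHom.ext fun p => ?_
  change ∑ k, χ k ((φ k p).unop • f x) = (u x : CharDual S P) p
  conv_rhs => rw [← hb p, map_sum]
  refine Finset.sum_congr rfl fun k _ => ?_
  rw [← map_smul f.hom, hχ, map_smul u.hom]
  rfl

end DualBasis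

/-! ### The isomorphism Hom_R(Hom_{Sᵒᵖ}(P, ω), I)⁺ = Hom_S(I_*, P⁺) -/

section CoTensor

variable {R S ω : Type u} [Ring R] [Ring S] [AddCommGroup ω] [Module R ω] [Module Sᵐᵒᵖ ω]
  [SMulCommClass R Sᵐᵒᵖ ω] [SMulCommClass Sᵐᵒᵖ R ω]

/-- Evaluation at `a`. -/
def homEvalAt {A : Type u} [AddCommGroup A] [Module Sᵐᵒᵖ A] (a : A) :
    (A →ₗ[Sᵐᵒᵖ] ω) →ₗ[R] ω where
  toFun g := g a
  map_add' _ _ := rfl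
  map_smul' _ _ := rfl

/-- An element of `M_*` as a linear map. -/
def Star.toLin {M : Type u} [AddCommGroup M] [Module R M] (f : Star R ω S M) : ω →ₗ[R] M := f

/-- The map `Hom_R(Hom_{Sᵒᵖ}(A, ω), I)⁺ → Hom_S(I_*, A⁺)`. -/
def coTensorChar (I A : Type u) [AddCommGroup I] [Module R I] [AddCommGroup A] [Module Sᵐᵒᵖ A]
    (χ : ((A →ₗ[Sᵐᵒᵖ] ω) →ₗ[R] I) →+ AddCircle (1 : ℚ)) : Star R ω S I →ₗ[S] CharDual S A where
  toFun f :=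
    ({ toFun := fun a => χ (f.toLin.comp (homEvalAt a))
       map_zero' := by
        rw [← map_zero χ]
        exact congrArg χ (LinearMap.ext fun g => (congrArg f (map_zero g)).trans
          (map_zero f.toLin))
       map_add' := fun a b => by
        rw [← map_add χ]
        exact congrArg χ (LinearMap.ext fun g => (congrArg f (map_add g a b)).trans
          (map_add f.toLin _ _)) } : A →+ AddCircle (1 : ℚ))
  map_add' f g := AddMonoidHom.ext fun a =>
    map_add χ (f.toLin.comp (homEvalAt a)) (g.toLin.comp (homEvalAt a))
  map_smul' s f := AddMonoidHom.ext fun a => congrArg χ <| LinearMap.ext fun g =>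
    congrArg f (map_smul g (MulOpposite.op s) a).symm

lemma coTensorChar_apply {I A : Type u} [AddCommGroup I] [Module R I] [AddCommGroup A]
    [Module Sᵐᵒᵖ A] (χ : ((A →ₗ[Sᵐᵒᵖ] ω) →ₗ[R] I) →+ AddCircle (1 : ℚ)) (f : Star R ω S I)
    (a : A) : coTensorChar I A χ f a = χ (f.toLin.comp (homEvalAt a)) := rfl

/-- A finite dual basis writes each h as the sum of the maps g ↦ (F k h)(g(b_k)) with F k h in I_*.
Hence χ is determined by its values on such maps, and prescribing those values inverts the
construction. -/
lemma coTensorChar_bijective (I P : Type u) [AddCommGroup I] [Module R I] [AddCommGroup P]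
    [Module Sᵐᵒᵖ P] [Module.Projective Sᵐᵒᵖ P] [Module.Finite Sᵐᵒᵖ P] :
    Function.Bijective (coTensorChar (R := R) (S := S) (ω := ω) I P) := by
  obtain ⟨n, b, φ, hb⟩ := exists_dual_basis Sᵐᵒᵖ P
  let G (k : Fin n) : ω →ₗ[R] (P →ₗ[Sᵐᵒᵖ] ω) :=
    { toFun := fun x => (LinearMap.toSpanSingleton Sᵐᵒᵖ ω x).comp (φ k)
      map_add' := fun x y => LinearMap.ext fun p => smul_add (φ k p) x y
      map_smul' := fun r x => LinearMap.ext fun p => (smul_comm r (φ k p) x).symm }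
  let F (k : Fin n) (h : (P →ₗ[Sᵐᵒᵖ] ω) →ₗ[R] I) : Star R ω S I := h.comp (G k)
  have hG : ∀ g : P →ₗ[Sᵐᵒᵖ] ω, ∑ k, G k (g (b k)) = g := by
    intro g
    refine LinearMap.ext fun p => ?_
    conv_rhs => rw [← hb p, map_sum]
    rw [LinearMap.sum_apply]
    refine Finset.sum_congr rfl fun k _ => ?_
    rw [map_smul]
    rfl
  constructor
  · intro χ ψ e
    refine AddMonoidHom.ext fun h => ?_
    let E (k : Fin n) : (P →ₗ[Sᵐᵒᵖ] ω) →ₗ[R] I := (F k h).toLin.comp (homEvalAt (b k))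
    have hE : ∑ k, E k = h := by
      refine LinearMap.ext fun g => ?_
      rw [LinearMap.sum_apply]
      conv_rhs => rw [← hG g, map_sum]
      rfl
    rw [← hE, map_sum, map_sum]
    refine Finset.sum_congr rfl fun k _ => ?_
    rw [← coTensorChar_apply χ (F k h) (b k), ← coTensorChar_apply ψ (F k h) (b k), e]
  · intro u
    refine ⟨{ toFun := fun h => ∑ k, u (F k h) (b k), map_zero' := ?_, map_add' := ?_ }, ?_⟩
    · refine Finset.sum_eq_zero fun k _ => ?_
      have : F k 0 = 0 := rfl
      rw [this, map_zero]; rfl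
    · intro h h'
      rw [← Finset.sum_add_distrib]
      refine Finset.sum_congr rfl fun k _ => ?_
      have : F k (h + h') = F k h + F k h' := rfl
      rw [this, map_add]; rfl
    · refine LinearMap.ext fun f => CharDual.ext (S := S) fun p => ?_
      change ∑ k, u (F k (f.toLin.comp (homEvalAt p))) (b k) = u f p
      conv_rhs => rw [← hb p, map_sum]
      refine Finset.sum_congr rfl fun k _ => ?_
      have h2 : u ((φ k p).unop • f) (b k) = u f (φ k p • b k) := by
        rw [map_smul]; rfl
      exact h2

/-- The character form of the exactness of `Hom_R(Hom_{Sᵒᵖ}(-, ω), I)`. -/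
lemma exists_coTensorChar_factor (I : ModuleCat.{u} R) [Injective I] {A B C : Type u}
    [AddCommGroup A] [Module Sᵐᵒᵖ A] [AddCommGroup B] [Module Sᵐᵒᵖ B] [AddCommGroup C]
    [Module Sᵐᵒᵖ C] [Module.Projective Sᵐᵒᵖ A] [Module.Finite Sᵐᵒᵖ A]
    [Module.Projective Sᵐᵒᵖ B] [Module.Finite Sᵐᵒᵖ B] (d : A →ₗ[Sᵐᵒᵖ] B) (e : B →ₗ[Sᵐᵒᵖ] C)
    (hde : ∀ g : B →ₗ[Sᵐᵒᵖ] ω, g.comp d = 0 → ∃ g' : C →ₗ[Sᵐᵒᵖ] ω, g'.comp e = g)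
    (u : Star R ω S I →ₗ[S] CharDual S B) (hu : ∀ f a, u f (d a) = 0) :
    ∃ χ, ∀ f b, coTensorChar (R := R) (S := S) (ω := ω) I C χ f (e b) = u f b := by
  obtain ⟨χ₀, rfl⟩ := (coTensorChar_bijective (R := R) (S := S) (ω := ω) I B).2 u
  let dS : (B →ₗ[Sᵐᵒᵖ] ω) →ₗ[R] (A →ₗ[Sᵐᵒᵖ] ω) :=
    { toFun := fun g => g.comp d, map_add' := fun _ _ => rfl, map_smul' := fun _ _ => rfl }
  let eS : (C →ₗ[Sᵐᵒᵖ] ω) →ₗ[R] (B →ₗ[Sᵐᵒᵖ] ω) :=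
    { toFun := fun g => g.comp e, map_add' := fun _ _ => rfl, map_smul' := fun _ _ => rfl }
  let Td : ((A →ₗ[Sᵐᵒᵖ] ω) →ₗ[R] I) →+ ((B →ₗ[Sᵐᵒᵖ] ω) →ₗ[R] I) :=
    { toFun := fun h => h.comp dS, map_zero' := rfl, map_add' := fun _ _ => rfl }
  let Te : ((B →ₗ[Sᵐᵒᵖ] ω) →ₗ[R] I) →+ ((C →ₗ[Sᵐᵒᵖ] ω) →ₗ[R] I) :=
    { toFun := fun h => h.comp eS, map_zero' := rfl, map_add' := fun _ _ => rfl }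
  have hTd : χ₀.comp Td = 0 := by
    apply (coTensorChar_bijective (R := R) (S := S) (ω := ω) I A).1
    refine LinearMap.ext fun f => CharDual.ext (S := S) fun a => ?_
    exact hu f a
  -- If Te h = 0, then h vanishes on the image of eS, which contains the kernel of dS by `hde`.
  -- Injectivity of I gives h = Td h', and χ₀ kills the image of Td.
  obtain ⟨χ, hχ⟩ := exists_character_extension Te χ₀ fun h hh => by
    obtain ⟨h', hh'⟩ := exists_linear_extension I dS h fun g hg => by
      obtain ⟨g', rfl⟩ := hde g hg
      exact DFunLike.congr_fun hh g'
    have : Td h' = h := LinearMap.ext hh'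
    rw [← this]
    exact DFunLike.congr_fun hTd h'
  refine ⟨χ, fun f b => ?_⟩
  exact hχ (f.toLin.comp (homEvalAt b))

end CoTensor

/-! ### The injective resolution P⁺ of ω⁺, and injective modules in the Bass class -/

section DualResolution

variable {S ω : Type u} [Ring S] [AddCommGroup ω] [Module Sᵐᵒᵖ ω]

/-- The augmentation of a projective resolution, as a linear map. -/
abbrev augmentation {A N : Type u} [Ring A] [AddCommGroup N] [Module A N]
    (P : ProjectiveResolution (ModuleCat.of A N)) : P.complex.X 0 →ₗ[A] N :=
  (show P.complex.X 0 ⟶ ModuleCat.of A N from P.π.f 0).hom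

lemma augmentation_surjective {A N : Type u} [Ring A] [AddCommGroup N] [Module A N]
    (P : ProjectiveResolution (ModuleCat.of A N)) : Function.Surjective (augmentation P) :=
  (ModuleCat.epi_iff_surjective (P.π.f 0)).1 inferInstance

lemma augmentation_eq_zero_iff {A N : Type u} [Ring A] [AddCommGroup N] [Module A N]
    (P : ProjectiveResolution (ModuleCat.of A N)) (x : P.complex.X 0) :
    augmentation P x = 0 ↔ ∃ y, P.complex.d 1 0 y = x := by
  constructor
  · intro hx
    exact (ShortComplex.moduleCat_exact_iff _).1 P.exact₀ x hx
  · rintro ⟨y, rfl⟩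
    exact ConcreteCategory.congr_hom P.complex_d_comp_π_f_zero y

end DualResolution

section DualResolution

variable {S ω : Type u} [Ring S] [AddCommGroup ω] [Module Sᵐᵒᵖ ω]

/-- The complex `P⁺` of left modules obtained from a complex `P` of right modules. -/
def charDualComplex (K : ChainComplex (ModuleCat.{u} Sᵐᵒᵖ) ℕ) :
    CochainComplex (ModuleCat.{u} S) ℕ :=
  CochainComplex.of (fun i => ModuleCat.of S (CharDual S (K.X i)))
    (fun i => ModuleCat.ofHom (charDualMap S (K.d (i + 1) i).hom)) fun i =>
      ModuleCat.hom_ext <| LinearMap.ext fun χ => AddMonoidHom.ext fun x =>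
        (congrArg χ (ConcreteCategory.congr_hom (K.d_comp_d (i + 2) (i + 1) i) x)).trans
          (map_zero χ)

lemma charDualComplex_d (K : ChainComplex (ModuleCat.{u} Sᵐᵒᵖ) ℕ) (i : ℕ) :
    (charDualComplex K).d i (i + 1) = ModuleCat.ofHom (charDualMap S (K.d (i + 1) i).hom) :=
  CochainComplex.of_d (fun i => ModuleCat.of S (CharDual S (K.X i)))
    (fun i => ModuleCat.ofHom (charDualMap S (K.d (i + 1) i).hom)) i

lemma charDualComplex_d_apply (K : ChainComplex (ModuleCat.{u} Sᵐᵒᵖ) ℕ) (i : ℕ)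
    (χ : CharDual S (K.X i)) (x : K.X (i + 1)) :
    DFunLike.coe (F := CharDual S (K.X (i + 1))) ((charDualComplex K).d i (i + 1) χ) x =
      χ (K.d (i + 1) i x) := by
  rw [charDualComplex_d]; rfl

lemma projective_X {A N : Type u} [Ring A] [AddCommGroup N] [Module A N]
    (P : ProjectiveResolution (ModuleCat.of A N)) (i : ℕ) :
    Module.Projective A (P.complex.X i) :=
  (IsProjective.iff_projective _).2 (P.projective i)

/-- The injective resolution `ω⁺ → P⁺` obtained from a resolution `P → ω` by finitely generated
projective right modules. -/
def charDualResolution (P : ProjectiveResolution (ModuleCat.of Sᵐᵒᵖ ω))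
    (hP : ∀ i, Module.Finite Sᵐᵒᵖ (P.complex.X i)) : InjectiveResolution (dualObj S ω) :=
  injectiveResolutionOfExact (charDualComplex P.complex)
    (fun i => by
      have := hP i
      have := projective_X P i
      exact injective_charDual S (P.complex.X i))
    (ModuleCat.ofHom (charDualMap S (augmentation P)))
    (fun χ ψ h => AddMonoidHom.ext fun x => by
      obtain ⟨y, rfl⟩ := augmentation_surjective P x
      exact DFunLike.congr_fun (F := CharDual S (P.complex.X 0)) h y)
    (fun χ => by
      constructor
      · intro h
        obtain ⟨ψ, hψ⟩ := (exact_iff_characters (P.complex.d 1 0).hom.toAddMonoidHom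
          (augmentation P).toAddMonoidHom).1
          (fun b hb => (augmentation_eq_zero_iff P b).1 hb) χ fun a => by
            have := DFunLike.congr_fun (F := CharDual S (P.complex.X 1)) h a
            exact (charDualComplex_d_apply P.complex 0 χ a).symm.trans this
        exact ⟨ψ, AddMonoidHom.ext hψ⟩
      · rintro ⟨ψ, rfl⟩
        refine AddMonoidHom.ext fun x => ?_
        refine (charDualComplex_d_apply P.complex 0 _ x).trans ?_
        refine (congrArg ψ ((augmentation_eq_zero_iff P _).2 ⟨x, rfl⟩)).trans (map_zero ψ))
    (fun i => by
      rw [cochain_exactAt_succ_iff]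
      intro χ h
      obtain ⟨ψ, hψ⟩ := (exact_iff_characters (P.complex.d (i + 2) (i + 1)).hom.toAddMonoidHom
          (P.complex.d (i + 1) i).hom.toAddMonoidHom).1
          ((exactAt_succ_iff _ _).1 (P.complex_exactAt_succ i)) χ fun a => by
            have := DFunLike.congr_fun (F := CharDual S (P.complex.X (i + 2))) h a
            exact (charDualComplex_d_apply P.complex (i + 1) χ a).symm.trans this
      refine ⟨ψ, AddMonoidHom.ext fun x => ?_⟩
      exact (charDualComplex_d_apply P.complex i _ x).trans (hψ x))

end DualResolution

section InjectiveBass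

variable {R S ω : Type u} [Ring R] [Ring S] [AddCommGroup ω] [Module R ω] [Module Sᵐᵒᵖ ω]
  [SMulCommClass R Sᵐᵒᵖ ω]

/-- Descent of a linear map along the augmentation. -/
lemma exists_desc_augmentation {A N T : Type u} [Ring A] [AddCommGroup N] [Module A N]
    [AddCommGroup T] [Module A T] (P : ProjectiveResolution (ModuleCat.of A N))
    (g : P.complex.X 0 →ₗ[A] T) (hg : g.comp (P.complex.d 1 0).hom = 0) :
    ∃ g' : N →ₗ[A] T, g'.comp (augmentation P) = g := by
  refine ⟨((LinearMap.ker (augmentation P)).liftQ g fun x hx => ?_).comp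
    ((augmentation P).quotKerEquivOfSurjective (augmentation_surjective P)).symm.toLinearMap,
    LinearMap.ext fun x => ?_⟩
  · obtain ⟨y, rfl⟩ := (augmentation_eq_zero_iff P x).1 hx
    exact DFunLike.congr_fun hg y
  · have : ((augmentation P).quotKerEquivOfSurjective (augmentation_surjective P)).symm
        (augmentation P x) = Submodule.Quotient.mk x := by
      rw [LinearEquiv.symm_apply_eq]
      rfl
    rw [LinearMap.comp_apply, LinearMap.comp_apply, LinearEquiv.coe_coe, this]
    rfl

/-- Injective modules belong to the Bass class. -/
lemma bassClass_of_injective (hω : IsSemidualizing R S ω) (I : ModuleCat.{u} R) [Injective I] :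
    bassClass R S ω I := by
  have : SMulCommClass Sᵐᵒᵖ R ω := SMulCommClass.symm R Sᵐᵒᵖ ω
  obtain ⟨P, hP⟩ := hω.finite_right
  have hP' := fun i => projective_X P i
  have hε := augmentation_surjective P
  rw [bassClass_iff]
  refine ⟨fun i => Abelian.Ext.subsingleton_of_injective _ _ i, fun i => ?_, ?_, ?_⟩
  · rw [ext_succ_subsingleton_iff_injective (charDualResolution P hP)]
    intro f hf
    -- The complex Hom_S(I_*, P⁺) is the dual of Hom_R(Hom_{Sᵒᵖ}(P, ω), I), which is exact here
    -- because Ext_{Sᵒᵖ}(ω, ω) vanishes in positive degrees and I is injective.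
    obtain ⟨χ, hχ⟩ := exists_coTensorChar_factor (R := R) (ω := ω) I
      (P.complex.d (i + 2) (i + 1)).hom (P.complex.d (i + 1) i).hom
      (fun g hg => by
        obtain ⟨g', hg'⟩ := (ext_succ_subsingleton_iff P i).1
          (hω.ext_right (i + 1) (Nat.le_add_left 1 i)) (ModuleCat.ofHom g) (ModuleCat.hom_ext hg)
        exact ⟨g'.hom, congrArg ModuleCat.Hom.hom hg'⟩)
      f.hom (fun h a => by
        have h1 := DFunLike.congr_fun (F := CharDual S (P.complex.X (i + 2)))
          (ConcreteCategory.congr_hom hf h) a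
        exact (charDualComplex_d_apply P.complex (i + 1) _ a).symm.trans h1)
    refine ⟨ModuleCat.ofHom (coTensorChar I (P.complex.X i) χ), ModuleCat.hom_ext ?_⟩
    refine LinearMap.ext fun h => AddMonoidHom.ext fun b => ?_
    exact (charDualComplex_d_apply P.complex i _ b).trans (hχ h b)
  · refine (injective_iff_map_eq_zero _).2 fun χ hχ => ?_
    let ε := augmentation P
    let T : ((P.complex.X 0 →ₗ[Sᵐᵒᵖ] ω) →ₗ[R] I) →+ I :=
      { toFun := fun h => h ε, map_zero' := rfl, map_add' := fun _ _ => rfl }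
    have h0 : χ.comp T = 0 := by
      apply (coTensorChar_bijective (R := R) (S := S) (ω := ω) I (P.complex.X 0)).1
      refine LinearMap.ext fun f => AddMonoidHom.ext fun p => ?_
      exact DFunLike.congr_fun (F := CharDual S ω) (DFunLike.congr_fun hχ f) (ε p)
    refine AddMonoidHom.ext fun m => ?_
    -- T is surjective: r ↦ r ε is injective because the left homothety map is, so 1 ↦ m extends
    -- along it to some h with h ε = m.
    obtain ⟨h, hh⟩ := exists_linear_extension I (LinearMap.toSpanSingleton R _ ε)
      (LinearMap.toSpanSingleton R I m) fun r hr => by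
        have : r = 0 := hω.homothety_left.1 <| LinearMap.ext fun x => by
          obtain ⟨p, rfl⟩ := hε x
          refine (DFunLike.congr_fun hr p).trans ?_
          exact (zero_smul R (ε p)).symm
        rw [this, map_zero]
    have h1 := hh 1
    rw [LinearMap.toSpanSingleton_apply, LinearMap.toSpanSingleton_apply, one_smul, one_smul] at h1
    rw [← h1]
    exact DFunLike.congr_fun h0 h
  · intro u
    obtain ⟨χ, hχ⟩ := exists_coTensorChar_factor (R := R) (ω := ω) I
      (P.complex.d 1 0).hom (augmentation P) (fun g hg => exists_desc_augmentation P g hg)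
      ((charDualMap S (augmentation P)).comp u) (fun f a => by
        refine (congrArg (u f) ((augmentation_eq_zero_iff P _).2 ⟨a, rfl⟩)).trans (map_zero (u f)))
    -- Homothety identifies Hom_R(Hom_{Sᵒᵖ}(ω, ω), I) with I, which turns χ into a character of I.
    let e : R ≃ₗ[R] (ω →ₗ[Sᵐᵒᵖ] ω) := LinearEquiv.ofBijective
      { toFun := fun r => homothetyLeft S ω r
        map_add' := fun r s => LinearMap.ext fun x => add_smul r s x
        map_smul' := fun r s => LinearMap.ext fun x => mul_smul r s x } hω.homothety_left
    refine ⟨{ toFun := fun m => χ ((LinearMap.toSpanSingleton R I m).comp e.symm.toLinearMap)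
              map_zero' := ?_
              map_add' := fun m n => ?_ }, LinearMap.ext fun f => AddMonoidHom.ext fun x => ?_⟩
    · rw [← map_zero χ]
      exact congrArg χ (LinearMap.ext fun g => smul_zero _)
    · rw [← map_add χ]
      exact congrArg χ (LinearMap.ext fun g => smul_add _ _ _)
    · obtain ⟨p, rfl⟩ := hε x
      refine Eq.trans ?_ (hχ f p)
      refine congrArg χ (LinearMap.ext fun g => ?_)
      obtain ⟨r, rfl⟩ := e.surjective g
      change e.symm (e r) • f (augmentation P p) = f (r • augmentation P p)
      rw [e.symm_apply_apply]
      exact (map_smul f.toLin r _).symm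

end InjectiveBass

/-! ### ω-projective modules belong to the Bass class -/

section OmegaProjective

open scoped TensorProduct

variable {R S ω : Type u} [Ring R] [Ring S] [AddCommGroup ω] [Module R ω] [Module Sᵐᵒᵖ ω]
  [SMulCommClass R Sᵐᵒᵖ ω]

/-- The unit `N → (ω ⊗_S N)_*`, `n ↦ (x ↦ x ⊗ n)`. -/
def unitMap (R ω : Type u) [Ring R] [AddCommGroup ω] [Module R ω] [Module Sᵐᵒᵖ ω]
    [SMulCommClass R Sᵐᵒᵖ ω] (N : Type u) [AddCommGroup N] [Module S N] :
    N →ₗ[S] Star R ω S (BiTensor R S ω N) where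
  toFun n :=
    ({ toFun := fun x => Submodule.Quotient.mk (x ⊗ₜ n)
       map_add' := fun x y => by rw [TensorProduct.add_tmul, Submodule.Quotient.mk_add]
       map_smul' := fun _ _ => rfl } : ω →ₗ[R] BiTensor R S ω N)
  map_add' n m := LinearMap.ext fun x =>
    (congrArg Submodule.Quotient.mk (TensorProduct.tmul_add x n m)).trans
      (Submodule.Quotient.mk_add _)
  map_smul' s n := LinearMap.ext fun x =>
    ((Submodule.Quotient.eq (balanced R S ω N)).2 (Submodule.subset_span ⟨x, s, n, rfl⟩)).symm

lemma mk_smul_tmul (N : Type u) [AddCommGroup N] [Module S N] (s : S) (n : N) (x : ω) :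
    (Submodule.Quotient.mk ((MulOpposite.op s • x) ⊗ₜ n) : BiTensor R S ω N) =
      Submodule.Quotient.mk (x ⊗ₜ (s • n)) :=
  (Submodule.Quotient.eq (balanced R S ω N)).2 (Submodule.subset_span ⟨x, s, n, rfl⟩)

/-- The map `S → ω_*` as a left `S`-linear map. -/
def homothetyStar (R S ω : Type u) [Ring R] [Ring S] [AddCommGroup ω] [Module R ω]
    [Module Sᵐᵒᵖ ω] [SMulCommClass R Sᵐᵒᵖ ω] : S →ₗ[S] Star R ω S ω where
  toFun s := homothetyRight R ω s
  map_add' s t := LinearMap.ext fun x => add_smul (MulOpposite.op s) (MulOpposite.op t) x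
  map_smul' s t := LinearMap.ext fun x => mul_smul (MulOpposite.op t) (MulOpposite.op s) x

/-- The map `ω ⊗_S P → ω` induced by a linear form on `P`. -/
def formMap {P : Type u} [AddCommGroup P] [Module S P] (φ : P →ₗ[S] S) :
    BiTensor R S ω P →ₗ[R] ω :=
  (theta R S ω ω).comp (tensorMap R ω ((homothetyStar R S ω).comp φ))

lemma tensorMap_surjective {N N' : Type u} [AddCommGroup N] [Module S N] [AddCommGroup N']
    [Module S N'] (f : N →ₗ[S] N') (hf : Function.Surjective f) :
    Function.Surjective (tensorMap R ω f) := by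
  intro t
  induction t using Submodule.Quotient.induction_on with
  | _ t =>
    induction t using TensorProduct.induction_on with
    | zero => exact ⟨0, map_zero _⟩
    | tmul x n =>
      obtain ⟨m, rfl⟩ := hf n
      exact ⟨Submodule.Quotient.mk (x ⊗ₜ m), rfl⟩
    | add a b ha hb =>
      obtain ⟨a', ha'⟩ := ha
      obtain ⟨b', hb'⟩ := hb
      exact ⟨a' + b', by rw [map_add, ha', hb', Submodule.Quotient.mk_add]⟩

section Coordinates

variable {P : Type u} [AddCommGroup P] [Module S P] (σ : P →ₗ[S] P →₀ S)

/-- The endomorphism of `ω ⊗_S P` that keeps the coordinates in `T`. -/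
def truncation (R ω : Type u) [Ring R] [AddCommGroup ω] [Module R ω] [Module Sᵐᵒᵖ ω]
    [SMulCommClass R Sᵐᵒᵖ ω] (T : Finset P) : BiTensor R S ω P →ₗ[R] BiTensor R S ω P :=
  ∑ c ∈ T, (unitMap R ω P c).toLin.comp (formMap ((Finsupp.lapply c).comp σ))

/-- σ splits the free cover of P on its own elements, and a tensor involves only finitely many of
these coordinates. Allowing every larger T makes finite unions possible. -/
lemma exists_truncation (hσ : Function.LeftInverse (Finsupp.linearCombination S id) σ)
    (t : BiTensor R S ω P) : ∃ T₀ : Finset P, ∀ T, T₀ ⊆ T → truncation σ R ω T t = t := by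
  classical
  induction t using Submodule.Quotient.induction_on with
  | _ t =>
    induction t using TensorProduct.induction_on with
    | zero => exact ⟨∅, fun T _ => map_zero _⟩
    | tmul x p =>
      refine ⟨(σ p).support, fun T hT => ?_⟩
      have h : ∑ c ∈ T, σ p c • c = p := by
        conv_rhs => rw [← hσ p, Finsupp.linearCombination_apply, Finsupp.sum]
        refine (Finset.sum_subset hT fun c _ hc => ?_).symm
        rw [Finsupp.notMem_support_iff.1 hc, zero_smul]
      have h2 : ∀ c, (unitMap R ω P c).toLin (formMap (R := R) ((Finsupp.lapply c).comp σ)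
          (Submodule.Quotient.mk (x ⊗ₜ p))) = (unitMap R ω P (σ p c • c)).toLin x :=
        fun c => mk_smul_tmul (R := R) P (σ p c) c x
      rw [truncation, LinearMap.sum_apply]
      refine (Finset.sum_congr rfl fun c _ => h2 c).trans ?_
      change _ = (unitMap R ω P p).toLin x
      conv_rhs => rw [← h, map_sum]
      exact (LinearMap.sum_apply T (fun c => (unitMap R ω P (σ p c • c)).toLin) x).symm
    | add a b ha hb =>
      obtain ⟨Ta, hTa⟩ := ha
      obtain ⟨Tb, hTb⟩ := hb
      refine ⟨Ta ∪ Tb, fun T hT => ?_⟩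
      rw [Submodule.Quotient.mk_add, map_add, hTa T (Finset.union_subset_left hT),
        hTb T (Finset.union_subset_right hT)]

/-- Plays the role of Hom_R(Q, -) commuting with direct sums for finitely generated Q: one finite
set of coordinates serves all generators. -/
lemma exists_truncation_comp (hσ : Function.LeftInverse (Finsupp.linearCombination S id) σ)
    {Q : Type u} [AddCommGroup Q] [Module R Q] [Module.Finite R Q]
    (f : Q →ₗ[R] BiTensor R S ω P) : ∃ T : Finset P, ∀ q, truncation σ R ω T (f q) = f q := by
  classical
  obtain ⟨s, hs⟩ := Module.Finite.fg_top (R := R) (M := Q)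
  choose T₀ hT₀ using exists_truncation (R := R) (ω := ω) σ hσ
  refine ⟨s.biUnion fun q => T₀ (f q), fun q => ?_⟩
  have : ⊤ ≤ LinearMap.eqLocus ((truncation σ R ω (s.biUnion fun q => T₀ (f q))).comp f) f := by
    rw [← hs, Submodule.span_le]
    intro q hq
    exact hT₀ _ _ (Finset.subset_biUnion_of_mem (fun q => T₀ (f q)) hq)
  exact this (Submodule.mem_top (x := q))

lemma truncation_apply (T : Finset P) (t : BiTensor R S ω P) :
    truncation σ R ω T t =
      ∑ c ∈ T, (unitMap R ω P c).toLin (formMap ((Finsupp.lapply c).comp σ) t) :=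
  LinearMap.sum_apply _ _ _

end Coordinates

variable (hω : IsSemidualizing R S ω) (P : Type u) [AddCommGroup P] [Module S P]
  [Module.Projective S P]

include hω

/-- A cocycle on a finitely generated term is a finite sum of its coordinates, which are cocycles
with values in ω. Each bounds because Ext_R(ω, ω) vanishes, and the bounding maps are added up. -/
lemma ext_tensor_projective (i : ℕ) :
    Subsingleton (Abelian.Ext (ModuleCat.of R ω) (ModuleCat.of R (BiTensor R S ω P)) (i + 1)) := by
  obtain ⟨Q, hQ⟩ := hω.finite_left
  obtain ⟨σ, hσ⟩ := Module.projective_def.1 ‹Module.Projective S P›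
  rw [ext_succ_subsingleton_iff Q]
  intro f hf
  have := hQ (i + 1)
  obtain ⟨T, hT⟩ := exists_truncation_comp σ hσ f.hom
  have hg : ∀ c : P, ∃ g : Q.complex.X i ⟶ ModuleCat.of R ω, Q.complex.d (i + 1) i ≫ g =
      f ≫ ModuleCat.ofHom (formMap ((Finsupp.lapply c).comp σ)) := fun c =>
    (ext_succ_subsingleton_iff Q i).1 (hω.ext_left (i + 1) (Nat.le_add_left 1 i)) _ <| by
      rw [reassoc_of% hf, zero_comp]
  choose g hg using hg
  refine ⟨ModuleCat.ofHom (∑ c ∈ T, (unitMap R ω P c).toLin.comp (g c).hom),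
    ModuleCat.hom_ext (LinearMap.ext fun q => ?_)⟩
  refine Eq.trans ?_ (hT q)
  rw [truncation_apply]
  refine (LinearMap.sum_apply _ _ _).trans (Finset.sum_congr rfl fun c _ => ?_)
  exact congrArg (unitMap R ω P c).toLin (ConcreteCategory.congr_hom (hg c) q)

lemma finite_of_isSemidualizing : Module.Finite R ω := by
  obtain ⟨Q, hQ⟩ := hω.finite_left
  have := hQ 0
  exact Module.Finite.of_surjective (augmentation Q) (augmentation_surjective Q)

/-- The coordinates of a map ω → ω ⊗_S P are endomorphisms of ω, hence elements of S by the right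
homothety. Finite generation of ω leaves finitely many of them. -/
lemma unitMap_bijective : Function.Bijective (unitMap (S := S) R ω P) := by
  obtain ⟨σ, hσ⟩ := Module.projective_def.1 ‹Module.Projective S P›
  constructor
  · refine (injective_iff_map_eq_zero _).2 fun p hp => ?_
    have h : σ p = 0 := Finsupp.ext fun c => hω.homothety_right.1 <| LinearMap.ext fun x => by
      have h1 := congrArg (formMap (R := R) (ω := ω) ((Finsupp.lapply c).comp σ))
        (DFunLike.congr_fun hp x)
      refine h1.trans ((map_zero _).trans ?_)
      exact (zero_smul Sᵐᵒᵖ x).symm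
    rw [← hσ p, h, map_zero]
  · intro h
    have := finite_of_isSemidualizing hω
    obtain ⟨T, hT⟩ := exists_truncation_comp σ hσ h.toLin
    choose s hs using fun c : P =>
      hω.homothety_right.2 ((formMap ((Finsupp.lapply c).comp σ)).comp h.toLin)
    refine ⟨∑ c ∈ T, s c • c, LinearMap.ext fun x => ?_⟩
    refine Eq.trans ?_ (hT x)
    rw [truncation_apply]
    rw [map_sum]
    refine (LinearMap.sum_apply T (fun c => (unitMap R ω P (s c • c)).toLin) x).trans
      (Finset.sum_congr rfl fun c _ => ?_)
    refine (mk_smul_tmul P (s c) c x).symm.trans ?_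
    exact congrArg (unitMap R ω P c).toLin (DFunLike.congr_fun (hs c) x)

/-- By the triangle identity θ is a left inverse of ω ⊗ unit, and that map is surjective. -/
lemma theta_tensor_bijective : Function.Bijective (theta R S ω (BiTensor R S ω P)) := by
  have h : (theta R S ω (BiTensor R S ω P)).comp (tensorMap R ω (unitMap R ω P)) =
      LinearMap.id := tensor_hom_ext R ω fun x p => rfl
  have hs := tensorMap_surjective (R := R) (ω := ω) _ (unitMap_bijective hω P).2
  constructor
  · intro a b hab
    obtain ⟨a, rfl⟩ := hs a
    obtain ⟨b, rfl⟩ := hs b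
    have h1 := DFunLike.congr_fun h a
    have h2 := DFunLike.congr_fun h b
    rw [LinearMap.comp_apply] at h1 h2
    rw [hab, h2] at h1
    exact congrArg _ h1.symm
  · intro t
    exact ⟨_, DFunLike.congr_fun h t⟩

lemma bassClass_tensor : bassClass R S ω (ModuleCat.of R (BiTensor R S ω P)) := by
  rw [bassClass_iff, ← theta_bijective_iff]
  refine ⟨ext_tensor_projective hω P, fun i => ?_, theta_tensor_bijective hω P⟩
  have : Module.Projective S (Star R ω S (BiTensor R S ω P)) :=
    Module.Projective.of_equiv (LinearEquiv.ofBijective _ (unitMap_bijective hω P))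
  have : Projective (starObj R S ω (ModuleCat.of R (BiTensor R S ω P))) :=
    (IsProjective.iff_projective _).1 this
  exact Abelian.Ext.subsingleton_of_projective _ _ i

end OmegaProjective

/-! ### Isomorphism invariance and ω-projective covers of Bass modules -/

section Closure

variable {R S ω : Type u} [Ring R] [Ring S] [AddCommGroup ω] [Module R ω] [Module Sᵐᵒᵖ ω]
  [SMulCommClass R Sᵐᵒᵖ ω]

lemma isShortExact_zero_iso {Z X Y : ModuleCat.{u} R} (hZ : IsZero Z) (e : X ≅ Y) :
    IsShortExact (0 : Z ⟶ X) e.hom where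
  injective a b _ := by
    have := ModuleCat.subsingleton_of_isZero hZ
    exact Subsingleton.elim a b
  exact x := by
    constructor
    · intro hx
      refine ⟨0, ?_⟩
      have h := ConcreteCategory.congr_hom e.hom_inv_id x
      have h2 : e.inv (e.hom x) = 0 := by rw [hx, map_zero]
      exact (map_zero _).trans (h2.symm.trans h)
    · rintro ⟨z, rfl⟩
      exact map_zero e.hom.hom
  surjective y := ⟨e.inv y, ConcreteCategory.congr_hom e.inv_hom_id y⟩

lemma isShortExact_iso_zero {Z X Y : ModuleCat.{u} R} (hZ : IsZero Z) (e : X ≅ Y) :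
    IsShortExact e.hom (0 : Y ⟶ Z) where
  injective := (ConcreteCategory.bijective_of_isIso e.hom).1
  exact x := ⟨fun _ => ⟨e.inv x, ConcreteCategory.congr_hom e.inv_hom_id x⟩, fun _ => rfl⟩
  surjective z := by
    have := ModuleCat.subsingleton_of_isZero hZ
    exact ⟨0, Subsingleton.elim _ _⟩

lemma isShortExact_ker {X Y : ModuleCat.{u} R} (g : X ⟶ Y) (hg : Function.Surjective g) :
    IsShortExact (ModuleCat.ofHom (LinearMap.ker g.hom).subtype) g where
  injective := Subtype.val_injective
  exact x := ⟨fun hx => ⟨⟨x, hx⟩, rfl⟩, by rintro ⟨z, rfl⟩; exact z.2⟩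
  surjective := hg

lemma isShortExact_quotient {X Y : ModuleCat.{u} R} (f : X ⟶ Y) (hf : Function.Injective f) :
    IsShortExact f (ModuleCat.ofHom (LinearMap.range f.hom).mkQ) where
  injective := hf
  exact _ := Submodule.Quotient.mk_eq_zero _
  surjective := Submodule.mkQ_surjective _

variable (hω : IsSemidualizing R S ω)

include hω

lemma bassClass_of_isZero {Z : ModuleCat.{u} R} (hZ : IsZero Z) : bassClass R S ω Z := by
  have : Injective Z := hZ.injective
  exact bassClass_of_injective hω Z

lemma bassClass_of_iso {X Y : ModuleCat.{u} R} (e : X ≅ Y) (hX : bassClass R S ω X) :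
    bassClass R S ω Y :=
  bassClass.cokernel (isShortExact_zero_iso (isZero_zero _) e)
    (bassClass_of_isZero hω (isZero_zero _)) hX

lemma bassClass_of_omegaProj {X : ModuleCat.{u} R} (hX : omegaProj R S ω X) :
    bassClass R S ω X := by
  obtain ⟨P, hP, ⟨e⟩⟩ := hX
  exact bassClass_of_iso hω e.symm (bassClass_tensor hω P)

/-- The class of `ω`-projective modules generates the Bass class. -/
lemma bassClass.exists_generator {X : ModuleCat.{u} R} (hX : bassClass R S ω X) :
    ∃ (Y G : ModuleCat.{u} R) (f : Y ⟶ G) (g : G ⟶ X), IsShortExact f g ∧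
      bassClass R S ω Y ∧ omegaProj R S ω G := by
  let q : (Star R ω S X →₀ S) →ₗ[S] Star R ω S X := Finsupp.linearCombination S id
  have hq : Function.Surjective q := Finsupp.linearCombination_id_surjective S _
  let P : ModuleCat.{u} S := ModuleCat.of S (Star R ω S X →₀ S)
  let G := ModuleCat.of R (BiTensor R S ω (Star R ω S X →₀ S))
  let g : G ⟶ X := ModuleCat.ofHom ((theta R S ω X).comp (tensorMap R ω q))
  have hG : bassClass R S ω G := bassClass_tensor hω _
  have hg : Function.Surjective g := hX.static.2.comp (tensorMap_surjective q hq)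
  have hs := isShortExact_ker g hg
  refine ⟨_, G, _, g, hs, ?_, P, inferInstanceAs (Module.Projective S (Star R ω S X →₀ S)),
    ⟨Iso.refl _⟩⟩
  -- Ext^1_R(ω, ker g) = 0 because every u : ω → X lifts to G: u is an element of X_*, so u = q p,
  -- and x ↦ x ⊗ p is a lift.
  refine bassClass.kernel hs (hs.ext_one_left (fun u => ?_) (hG.ext_eq_zero 1 le_rfl)) hG hX
  obtain ⟨p, hp⟩ := hq (show Star R ω S X from u.hom)
  refine ⟨ModuleCat.ofHom (unitMap R ω _ p).toLin, ModuleCat.hom_ext (LinearMap.ext fun x => ?_)⟩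
  exact DFunLike.congr_fun hp x

end Closure

/-! ### Coresolutions as iterated short exact sequences -/

section Coresolutions

variable {R : Type u} [Ring R]

/-- There is an exact sequence `0 → M → X⁰ → ⋯ → Xⁿ → 0` with all `Xⁱ` in `𝒳`, given recursively by
short exact sequences. -/
def CoresLE (𝒳 : ModuleCat.{u} R → Prop) : ℕ → ModuleCat.{u} R → Prop
  | 0, M => 𝒳 M
  | n + 1, M => ∃ (X M' : ModuleCat.{u} R) (f : M ⟶ X) (g : X ⟶ M'),
      IsShortExact f g ∧ 𝒳 X ∧ CoresLE 𝒳 n M'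

variable {𝒳 : ModuleCat.{u} R → Prop}

lemma CoresLE.mono_class {𝒴 : ModuleCat.{u} R → Prop} (h : ∀ X, 𝒳 X → 𝒴 X) {n : ℕ} :
    ∀ {M : ModuleCat.{u} R}, CoresLE 𝒳 n M → CoresLE 𝒴 n M := by
  induction n with
  | zero => exact h _
  | succ n ih =>
    rintro M ⟨X, M', f, g, hs, hX, hM'⟩
    exact ⟨X, M', f, g, hs, h X hX, ih hM'⟩

lemma CoresLE.succ (h₀ : ∀ Z, IsZero Z → 𝒳 Z) {n : ℕ} :
    ∀ {M : ModuleCat.{u} R}, CoresLE 𝒳 n M → CoresLE 𝒳 (n + 1) M := by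
  induction n with
  | zero =>
    intro M hM
    exact ⟨M, _, 𝟙 M, _, isShortExact_iso_zero (isZero_zero _) (Iso.refl M), hM,
      h₀ _ (isZero_zero _)⟩
  | succ n ih =>
    rintro M ⟨X, M', f, g, hs, hX, hM'⟩
    exact ⟨X, M', f, g, hs, hX, ih hM'⟩

lemma CoresLE.mono (h₀ : ∀ Z, IsZero Z → 𝒳 Z) {n m : ℕ} (hnm : n ≤ m) {M : ModuleCat.{u} R}
    (h : CoresLE 𝒳 n M) : CoresLE 𝒳 m M := by
  induction hnm with
  | refl => exact h
  | step _ ih => exact ih.succ h₀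

lemma isShortExact_range {X Y : ModuleCat.{u} R} {M : ModuleCat.{u} R} (f : M ⟶ X) (g : X ⟶ Y)
    (hf : Function.Injective f) (hfg : ∀ x, g x = 0 ↔ ∃ m, f m = x) :
    IsShortExact f (ModuleCat.ofHom g.hom.rangeRestrict :
      X ⟶ ModuleCat.of R (LinearMap.range g.hom)) where
  injective := hf
  exact x := Subtype.ext_iff.trans (hfg x)
  surjective := LinearMap.surjective_rangeRestrict _

lemma Coresolution.exact_zero_apply {M : ModuleCat.{u} R} {n : ℕ} (c : Coresolution 𝒳 M n)
    (x : c.X.X 0) : c.X.d 0 1 x = 0 ↔ ∃ m, c.ε m = x := by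
  constructor
  · exact (ShortComplex.moduleCat_exact_iff _).1 c.exact_zero x
  · rintro ⟨m, rfl⟩
    exact ConcreteCategory.congr_hom c.comp_zero m

lemma Coresolution.injective {M : ModuleCat.{u} R} {n : ℕ} (c : Coresolution 𝒳 M n) :
    Function.Injective c.ε :=
  (ModuleCat.mono_iff_injective _).1 c.mono

/-- The coresolution of the first cosyzygy. -/
def Coresolution.tail {M : ModuleCat.{u} R} {n : ℕ} (c : Coresolution 𝒳 M (n + 1)) :
    Coresolution 𝒳 (ModuleCat.of R (LinearMap.range (c.X.d 0 1).hom)) n where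
  X := CochainComplex.truncate.obj c.X
  ε := ModuleCat.ofHom (LinearMap.range (c.X.d 0 1).hom).subtype
  mono := (ModuleCat.mono_iff_injective _).2 Subtype.val_injective
  comp_zero := ModuleCat.hom_ext <| LinearMap.ext fun ⟨x, hx⟩ => by
    obtain ⟨y, rfl⟩ := hx
    exact ConcreteCategory.congr_hom (c.X.d_comp_d 0 1 2) y
  exact_zero := (ShortComplex.moduleCat_exact_iff _).2 fun x hx => by
    obtain ⟨y, hy⟩ := (cochain_exactAt_succ_iff _ _).1 (c.exact_succ 0) x hx
    exact ⟨⟨x, y, hy⟩, rfl⟩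
  exact_succ i := (cochain_exactAt_succ_iff _ _).2
    ((cochain_exactAt_succ_iff c.X (i + 1)).1 (c.exact_succ (i + 1)))
  mem i hi := c.mem (i + 1) (Nat.succ_le_succ hi)
  isZero i hi := c.isZero (i + 1) (Nat.succ_lt_succ hi)

lemma Coresolution.coresLE (hiso : ∀ X Y : ModuleCat.{u} R, (X ≅ Y) → 𝒳 X → 𝒳 Y) {n : ℕ} :
    ∀ {M : ModuleCat.{u} R}, Coresolution 𝒳 M n → CoresLE 𝒳 n M := by
  induction n with
  | zero =>
    intro M c
    have : IsIso c.ε := by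
      rw [ConcreteCategory.isIso_iff_bijective]
      refine ⟨c.injective, fun x => (c.exact_zero_apply x).1 ?_⟩
      have := ModuleCat.subsingleton_of_isZero (c.isZero 1 Nat.one_pos)
      exact Subsingleton.elim _ _
    exact hiso _ _ (asIso c.ε).symm (c.mem 0 le_rfl)
  | succ n ih =>
    intro M c
    exact ⟨_, _, _, _, isShortExact_range c.ε (c.X.d 0 1) c.injective c.exact_zero_apply,
      c.mem 0 (Nat.zero_le _), ih c.tail⟩

/-- The coresolution of length zero. -/
def Coresolution.single {M : ModuleCat.{u} R} (hM : 𝒳 M) : Coresolution 𝒳 M 0 where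
  X := (CochainComplex.single₀ (ModuleCat.{u} R)).obj M
  ε := 𝟙 M
  mono := inferInstanceAs (Mono (𝟙 M))
  comp_zero := Limits.comp_zero
  exact_zero := (ShortComplex.moduleCat_exact_iff _).2 fun x _ => ⟨x, rfl⟩
  exact_succ i := CochainComplex.exactAt_succ_single_obj _ _
  mem i hi := by
    obtain rfl := Nat.le_zero.1 hi
    exact hM
  isZero i hi := HomologicalComplex.isZero_single_obj_X _ _ _ _ (by omega)

/-- Prepending a term to a coresolution. -/
def Coresolution.cons {M X M' : ModuleCat.{u} R} {f : M ⟶ X} {g : X ⟶ M'} {n : ℕ}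
    (h : IsShortExact f g) (hX : 𝒳 X) (c : Coresolution 𝒳 M' n) : Coresolution 𝒳 M (n + 1) where
  X := CochainComplex.augment c.X (g ≫ c.ε) (by
    rw [Category.assoc, c.comp_zero]; exact Limits.comp_zero)
  ε := f
  mono := (ModuleCat.mono_iff_injective _).2 h.injective
  comp_zero := (Category.assoc f g c.ε).symm.trans (by
    rw [h.comp_eq_zero]; exact Limits.zero_comp)
  exact_zero := (ShortComplex.moduleCat_exact_iff _).2 fun x hx =>
    (h.exact x).1 (c.injective (Eq.trans hx (map_zero c.ε.hom).symm))
  exact_succ i := by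
    rw [cochain_exactAt_succ_iff]
    cases i with
    | zero =>
      intro x hx
      obtain ⟨m, rfl⟩ := (c.exact_zero_apply x).1 hx
      obtain ⟨y, rfl⟩ := h.surjective m
      exact ⟨y, rfl⟩
    | succ i => exact (cochain_exactAt_succ_iff c.X i).1 (c.exact_succ i)
  mem i hi := by
    cases i with
    | zero => exact hX
    | succ i => exact c.mem i (Nat.le_of_succ_le_succ hi)
  isZero i hi := by
    cases i with
    | zero => omega
    | succ i => exact c.isZero i (Nat.lt_of_succ_lt_succ hi)

lemma CoresLE.nonempty_coresolution {n : ℕ} :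
    ∀ {M : ModuleCat.{u} R}, CoresLE 𝒳 n M → Nonempty (Coresolution 𝒳 M n) := by
  induction n with
  | zero => exact fun hM => ⟨Coresolution.single hM⟩
  | succ n ih =>
    rintro M ⟨X, M', f, g, hs, hX, hM'⟩
    obtain ⟨c⟩ := ih hM'
    exact ⟨Coresolution.cons hs hX c⟩

lemma exists_coresolution_of_injDim_le {M : ModuleCat.{u} R} {n : ℕ} (h : injDim 𝒳 M ≤ n) :
    ∃ k ≤ n, Nonempty (Coresolution 𝒳 M k) := by
  by_contra hc
  push Not at hc
  have : ((n + 1 : ℕ) : ℕ∞) ≤ injDim 𝒳 M := by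
    refine le_iInf₂ fun k hk => ?_
    by_contra hlt
    have hkn : k ≤ n := by
      have := not_le.1 hlt
      exact Nat.lt_succ_iff.1 (by exact_mod_cast this)
    exact (not_isEmpty_iff.2 hk) (hc k hkn)
  have := this.trans h
  have : n + 1 ≤ n := by exact_mod_cast this
  omega

/-- The dimension in terms of short exact sequences. -/
lemma injDim_le_iff (h₀ : ∀ Z, IsZero Z → 𝒳 Z)
    (hiso : ∀ X Y : ModuleCat.{u} R, (X ≅ Y) → 𝒳 X → 𝒳 Y) (M : ModuleCat.{u} R) (n : ℕ) :
    injDim 𝒳 M ≤ n ↔ CoresLE 𝒳 n M := by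
  constructor
  · intro h
    obtain ⟨k, hk, ⟨c⟩⟩ := exists_coresolution_of_injDim_le h
    exact (c.coresLE hiso).mono h₀ hk
  · intro h
    exact iInf₂_le n h.nonempty_coresolution

end Coresolutions

/-! ### Pullbacks and products of short exact sequences -/

section Constructions

variable {R : Type u} [Ring R] {K X Y Z W : ModuleCat.{u} R}

lemma IsShortExact.exists_desc {f : K ⟶ X} {g : X ⟶ Y} (h : IsShortExact f g) (t : X ⟶ Z)
    (ht : f ≫ t = 0) : ∃ s : Y ⟶ Z, ∀ x, s (g x) = t x := by
  obtain ⟨s, hs⟩ := ((h.precompHom_exact R Z).2 t.hom).1 (congrArg ModuleCat.Hom.hom ht)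
  exact ⟨ModuleCat.ofHom s, DFunLike.congr_fun hs⟩

/-- Pullback of a short exact sequence. -/
lemma IsShortExact.exists_pullback {k : K ⟶ X} {g : X ⟶ Z} (s : IsShortExact k g) (h : W ⟶ Z) :
    ∃ (Q : ModuleCat.{u} R) (a : K ⟶ Q) (p : Q ⟶ X) (q : Q ⟶ W), IsShortExact a q ∧
      (∀ t, g (p t) = h (q t)) ∧ (∀ t, p t = 0 → q t = 0 → t = 0) ∧
      ∀ x w, g x = h w → ∃ t, p t = x ∧ q t = w := by
  let D : X × W →ₗ[R] Z := g.hom.comp (LinearMap.fst R X W) - h.hom.comp (LinearMap.snd R X W)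
  have hD : ∀ x w, D (x, w) = 0 ↔ g x = h w := fun x w => sub_eq_zero
  let a : K →ₗ[R] LinearMap.ker D :=
    (LinearMap.inl R X W ∘ₗ k.hom).codRestrict _ fun y =>
      (hD _ _).2 ((s.map_eq_zero y).trans (map_zero h.hom).symm)
  refine ⟨ModuleCat.of R (LinearMap.ker D), ModuleCat.ofHom a,
    ModuleCat.ofHom ((LinearMap.fst R X W).comp (LinearMap.ker D).subtype),
    ModuleCat.ofHom ((LinearMap.snd R X W).comp (LinearMap.ker D).subtype), ⟨?_, ?_, ?_⟩, ?_, ?_, ?_⟩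
  · intro y z hyz
    exact s.injective (congrArg (fun t : LinearMap.ker D => t.1.1) hyz)
  · rintro ⟨⟨x, w⟩, hxw⟩
    constructor
    · intro hw
      obtain rfl : w = 0 := hw
      obtain ⟨y, rfl⟩ := (s.exact x).1 (((hD _ _).1 hxw).trans (map_zero h.hom))
      exact ⟨y, rfl⟩
    · rintro ⟨y, hy⟩
      exact (congrArg (fun t : LinearMap.ker D => t.1.2) hy).symm
  · intro w
    obtain ⟨x, hx⟩ := s.surjective (h w)
    exact ⟨⟨(x, w), (hD _ _).2 hx⟩, rfl⟩
  · rintro ⟨⟨x, w⟩, hxw⟩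
    exact (hD _ _).1 hxw
  · rintro ⟨⟨x, w⟩, hxw⟩ h1 h2
    exact Subtype.ext (Prod.ext h1 h2)
  · intro x w hxw
    exact ⟨⟨(x, w), (hD _ _).2 hxw⟩, rfl, rfl⟩

/-- The second short exact sequence of a pullback. -/
lemma IsShortExact.pullback_left {Q L : ModuleCat.{u} R} {g : X ⟶ Z} {h : W ⟶ Z} {l : L ⟶ W}
    {p : Q ⟶ X} {q : Q ⟶ W} (s : IsShortExact l h) (hc : ∀ t, g (p t) = h (q t))
    (hi : ∀ t, p t = 0 → q t = 0 → t = 0) (he : ∀ x w, g x = h w → ∃ t, p t = x ∧ q t = w) :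
    ∃ b : L ⟶ Q, IsShortExact b p := by
  have hb : ∀ y : L, ∃ t, p t = 0 ∧ q t = l y := fun y =>
    he 0 (l y) ((map_zero g.hom).trans (s.map_eq_zero y).symm)
  choose b hb0 hb1 using hb
  have huniq : ∀ t t', p t = p t' → q t = q t' → t = t' := fun t t' h1 h2 => by
    rw [← sub_eq_zero]
    exact hi _ (by rw [map_sub, h1, sub_self]) (by rw [map_sub, h2, sub_self])
  let B : L →ₗ[R] Q :=
    { toFun := b
      map_add' := fun x y => huniq _ _ (by rw [map_add, hb0, hb0, hb0, add_zero])
        (by rw [map_add, hb1, hb1, hb1, map_add])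
      map_smul' := fun r x => huniq _ _
        (by rw [RingHom.id_apply, hb0]; exact ((map_smul p.hom r (b x)).trans
              ((congrArg (r • ·) (hb0 x)).trans (smul_zero r))).symm)
        (by rw [RingHom.id_apply, hb1]; exact (map_smul l.hom r x).trans
              (((map_smul q.hom r (b x)).trans (congrArg (r • ·) (hb1 x))).symm)) }
  refine ⟨ModuleCat.ofHom B, fun y z hyz => s.injective ?_, fun t => ⟨fun ht => ?_, ?_⟩, fun x => ?_⟩
  · rw [← hb1, ← hb1]; exact congrArg q hyz
  · obtain ⟨y, hy⟩ := (s.exact (q t)).1 (by rw [← hc, ht, map_zero])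
    exact ⟨y, huniq _ _ ((hb0 y).trans ht.symm) ((hb1 y).trans hy)⟩
  · rintro ⟨y, rfl⟩
    exact hb0 y
  · obtain ⟨w, hw⟩ := s.surjective (g x)
    obtain ⟨t, ht, -⟩ := he x w hw.symm
    exact ⟨t, ht⟩

lemma isShortExact_prod (X Y : ModuleCat.{u} R) :
    IsShortExact (ModuleCat.ofHom (LinearMap.inl R X Y)) (ModuleCat.ofHom (LinearMap.snd R X Y)) where
  injective := LinearMap.inl_injective
  exact := Function.Exact.inl_snd
  surjective := LinearMap.snd_surjective

lemma IsShortExact.prod_left {f : K ⟶ X} {g : X ⟶ Y} (h : IsShortExact f g)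
    (W : ModuleCat.{u} R) :
    IsShortExact (ModuleCat.ofHom (LinearMap.prodMap LinearMap.id f.hom : (W × K) →ₗ[R] W × X))
      (ModuleCat.ofHom (g.hom.comp (LinearMap.snd R W X))) where
  injective a b hab := by
    have h1 : a.1 = b.1 := congrArg (fun t : W × X => t.1) hab
    have h2 : f a.2 = f b.2 := congrArg (fun t : W × X => t.2) hab
    exact Prod.ext h1 (h.injective h2)
  exact := by
    rintro ⟨w, x⟩
    constructor
    · intro hx
      obtain ⟨y, rfl⟩ := (h.exact x).1 hx
      exact ⟨(w, y), rfl⟩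
    · rintro ⟨y, hy⟩
      obtain rfl : f y.2 = x := congrArg Prod.snd hy
      exact h.map_eq_zero y.2
  surjective y := by
    obtain ⟨x, rfl⟩ := h.surjective y
    exact ⟨(0, x), rfl⟩

end Constructions

/-! ### Bass dimension, Ext vanishing and approximations -/

section Bass

variable {R S ω : Type u} [Ring R] [Ring S] [AddCommGroup ω] [Module R ω] [Module Sᵐᵒᵖ ω]
  [SMulCommClass R Sᵐᵒᵖ ω]

lemma CoresLE.ext_eq_zero {n : ℕ} : ∀ {M : ModuleCat.{u} R}, CoresLE (bassClass R S ω) n M →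
    ∀ i, n + 1 ≤ i → Subsingleton (Abelian.Ext (ModuleCat.of R ω) M i) := by
  induction n with
  | zero => exact fun hM i hi => bassClass.ext_eq_zero hM i hi
  | succ n ih =>
    rintro M ⟨X, M', f, g, hs, hX, hM'⟩ i hi
    cases i with
    | zero => omega
    | succ i => exact hs.ext_left (ih hM' i (by omega)) (hX.ext_eq_zero _ (by omega))

/-- A module of finite Bass injective dimension with vanishing `Ext^i_R(ω, -)` for `i ≥ 1` lies in
the Bass class. -/
lemma CoresLE.bassClass_of_ext {n : ℕ} : ∀ {M : ModuleCat.{u} R},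
    CoresLE (bassClass R S ω) n M →
    (∀ i, 1 ≤ i → Subsingleton (Abelian.Ext (ModuleCat.of R ω) M i)) → bassClass R S ω M := by
  induction n with
  | zero => exact fun hM _ => hM
  | succ n ih =>
    rintro M ⟨X, M', f, g, hs, hX, hM'⟩ he
    -- The vanishing passes to M', which is therefore in the class by induction; M is then the
    -- kernel of X → M'.
    exact bassClass.kernel hs (he 1 le_rfl) hX (ih hM' fun i hi =>
      hs.ext_right (hX.ext_eq_zero i hi) (he (i + 1) (by omega)))

/-- If Q embeds in a Bass module X' with cokernel M', then C = Q/X embeds in X'/X with the same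
cokernel M', and X'/X is again Bass. -/
lemma CoresLE.cokernel {n : ℕ} {X Q C : ModuleCat.{u} R} {f : X ⟶ Q} {g : Q ⟶ C}
    (hs : IsShortExact f g) (hX : bassClass R S ω X) (hQ : CoresLE (bassClass R S ω) n Q) :
    CoresLE (bassClass R S ω) n C := by
  cases n with
  | zero => exact bassClass.cokernel hs hX hQ
  | succ n =>
    obtain ⟨X', M', i, p, hs', hX', hM'⟩ := hQ
    have hq := isShortExact_quotient (f ≫ i) (hs'.injective.comp hs.injective)
    obtain ⟨s, hsg⟩ := hs.exists_desc (i ≫ ModuleCat.ofHom (LinearMap.range (f ≫ i).hom).mkQ)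
      (by rw [← Category.assoc]; exact hq.comp_eq_zero)
    obtain ⟨t, ht⟩ := hq.exists_desc p (by rw [Category.assoc, hs'.comp_eq_zero, comp_zero])
    refine ⟨_, M', s, t, ⟨?_, ?_, ?_⟩, bassClass.cokernel hq hX hX', hM'⟩
    · refine (injective_iff_map_eq_zero s.hom).2 fun c hc => ?_
      obtain ⟨q, rfl⟩ := hs.surjective c
      obtain ⟨x, hx⟩ := (hq.exact (i q)).1 ((hsg q).symm.trans hc)
      rw [← hs'.injective hx]
      exact hs.map_eq_zero x
    · intro y
      obtain ⟨x', rfl⟩ := hq.surjective y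
      constructor
      · intro hy
        obtain ⟨q, rfl⟩ := (hs'.exact x').1 ((ht x').symm.trans hy)
        exact ⟨g q, hsg q⟩
      · rintro ⟨c, hc⟩
        obtain ⟨q, rfl⟩ := hs.surjective c
        rw [← hc, hsg q]
        exact (ht (i q)).trans (hs'.map_eq_zero q)
    · intro m
      obtain ⟨x', rfl⟩ := hs'.surjective m
      exact ⟨_, ht x'⟩

lemma CoresLE.prod {n : ℕ} {I M : ModuleCat.{u} R} (hI : bassClass R S ω I)
    (hM : CoresLE (bassClass R S ω) n M) :
    CoresLE (bassClass R S ω) n (ModuleCat.of R (I × M)) := by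
  cases n with
  | zero => exact bassClass.extension (isShortExact_prod I M) hI hM
  | succ n =>
    obtain ⟨X, M', f, g, hs, hX, hM'⟩ := hM
    exact ⟨_, M', _, _, hs.prod_left I, bassClass.extension (isShortExact_prod I X) hI hX, hM'⟩

/-- The pullback Q of X → M' and V → M' is an extension of V by M and of X by Y; the latter makes Q
Bass. Taking `ih` as a hypothesis lets the left and right approximations share one induction. -/
lemma CoresLE.exists_right_approximation {n : ℕ}
    (ih : ∀ {M : ModuleCat.{u} R}, CoresLE (bassClass R S ω) n M →
      ∃ (Y V : ModuleCat.{u} R) (a : Y ⟶ V) (b : V ⟶ M), IsShortExact a b ∧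
        bassClass R S ω Y ∧ CoresLE (omegaProj R S ω) n V)
    {M : ModuleCat.{u} R} (hM : CoresLE (bassClass R S ω) (n + 1) M) :
    ∃ (X W : ModuleCat.{u} R) (f : M ⟶ X) (g : X ⟶ W), IsShortExact f g ∧
      bassClass R S ω X ∧ CoresLE (omegaProj R S ω) n W := by
  obtain ⟨X, M', f, g, hs, hX, hM'⟩ := hM
  obtain ⟨Y, V, a, b, hab, hY, hV⟩ := ih hM'
  obtain ⟨Q, c, p, q, hcq, hc, hi, he⟩ := hs.exists_pullback b
  obtain ⟨d, hd⟩ := hab.pullback_left hc hi he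
  exact ⟨Q, V, c, q, hcq, bassClass.extension hd hY hX, hV⟩

variable (hω : IsSemidualizing R S ω)

include hω

/-- Cosyzygies do not raise the Bass injective dimension. -/
lemma CoresLE.cosyzygy_step {n : ℕ} {M I C : ModuleCat.{u} R} [Injective I] {j : M ⟶ I} {π : I ⟶ C}
    (hs : IsShortExact j π) (hM : CoresLE (bassClass R S ω) n M) :
    CoresLE (bassClass R S ω) n C := by
  have hI := bassClass_of_injective hω I
  cases n with
  | zero => exact bassClass.cokernel hs hM hI
  | succ n =>
    obtain ⟨X, M', f, p, hf, hX, hM'⟩ := hM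
    have : Mono f := (ModuleCat.mono_iff_injective f).2 hf.injective
    let e := Injective.factorThru j f
    have he : ∀ m, e (f m) = j m := ConcreteCategory.congr_hom (Injective.comp_factorThru j f)
    obtain ⟨h, hh⟩ := hf.exists_desc (e ≫ π) (by
      rw [← Category.assoc, Injective.comp_factorThru, hs.comp_eq_zero])
    -- Comparing the two embeddings of M gives 0 → X → I × M' → C → 0 with X Bass and I × M' of Bass
    -- dimension at most n, so the quotient C has dimension at most n as well.
    let a : X ⟶ ModuleCat.of R (I × M') := ModuleCat.ofHom (e.hom.prod p.hom)
    let b : ModuleCat.of R (I × M') ⟶ C := ModuleCat.ofHom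
      (π.hom.comp (LinearMap.fst R I M') - h.hom.comp (LinearMap.snd R I M'))
    have hb : ∀ i m, b (i, m) = π i - h m := fun _ _ => rfl
    have hab : IsShortExact a b := by
      refine ⟨(injective_iff_map_eq_zero a.hom).2 fun x hx => ?_, ?_, fun c => ?_⟩
      · obtain ⟨m, rfl⟩ := (hf.exact x).1 (congrArg Prod.snd hx)
        have : j m = 0 := (he m).symm.trans (congrArg Prod.fst hx)
        rw [hs.injective (this.trans (map_zero j.hom).symm), map_zero]
      · rintro ⟨i, m'⟩
        obtain ⟨x, rfl⟩ := hf.surjective m'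
        rw [hb, hh x]
        constructor
        · intro hi
          obtain ⟨m, hm⟩ := (hs.exact (i - e x)).1 ((map_sub π.hom _ _).trans hi)
          refine ⟨x + f m, Prod.ext ?_ ?_⟩
          · change e (x + f m) = i
            rw [map_add, he, hm, add_sub_cancel]
          · change p (x + f m) = p x
            rw [map_add, hf.map_eq_zero, add_zero]
        · rintro ⟨y, hy⟩
          have h1 : e y = i := congrArg Prod.fst hy
          have h2 : p y = p x := congrArg Prod.snd hy
          rw [← hh x, ← h2, hh y, ← h1]
          exact sub_self _
      · obtain ⟨i, rfl⟩ := hs.surjective c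
        exact ⟨(i, 0), by rw [hb, map_zero, sub_zero]⟩
    exact (CoresLE.cokernel hab hX (CoresLE.prod hI hM')).succ
      fun Z hZ => bassClass_of_isZero hω hZ

/-- If `0 → M → Q → W → 0` is exact with `Q` in the Bass class and `W` of `ω`-projective dimension
at most `n`, then `M` is a quotient of a module of `ω`-projective dimension at most `n + 1`. -/
lemma exists_left_approximation {n : ℕ} {M Q W : ModuleCat.{u} R} {f : M ⟶ Q} {g : Q ⟶ W}
    (hs : IsShortExact f g) (hQ : bassClass R S ω Q) (hW : CoresLE (omegaProj R S ω) n W) :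
    ∃ (Y V : ModuleCat.{u} R) (a : Y ⟶ V) (b : V ⟶ M), IsShortExact a b ∧
      bassClass R S ω Y ∧ CoresLE (omegaProj R S ω) (n + 1) V := by
  obtain ⟨Y, G, k, q, hk, hY, hG⟩ := hQ.exists_generator hω
  obtain ⟨V, a, p, b, hab, hc, hi, he⟩ := hk.exists_pullback f
  -- V is the preimage of M in G, so G/V = Q/M = W: prepending the ω-projective G costs one step.
  refine ⟨Y, V, a, b, hab, hY, G, W, p, q ≫ g, ⟨?_, fun x => ⟨fun hx => ?_, ?_⟩, ?_⟩, hG, hW⟩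
  · refine (injective_iff_map_eq_zero p.hom).2 fun t ht => hi t ht (hs.injective ?_)
    rw [← hc, map_zero]
    exact (congrArg q ht).trans (map_zero q.hom)
  · obtain ⟨m, hm⟩ := (hs.exact (q x)).1 hx
    obtain ⟨t, ht, -⟩ := he x m hm.symm
    exact ⟨t, ht⟩
  · rintro ⟨t, rfl⟩
    exact (congrArg g (hc t)).trans (hs.map_eq_zero _)
  · exact hs.surjective.comp hk.surjective

/-- Modules of Bass injective dimension at most `n` are quotients of modules of `ω`-projective
injective dimension at most `n` by modules in the Bass class. -/
lemma CoresLE.exists_left_approximation {n : ℕ} : ∀ {M : ModuleCat.{u} R},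
    CoresLE (bassClass R S ω) n M →
      ∃ (Y V : ModuleCat.{u} R) (a : Y ⟶ V) (b : V ⟶ M), IsShortExact a b ∧
        bassClass R S ω Y ∧ CoresLE (omegaProj R S ω) n V := by
  induction n with
  | zero =>
    intro M hM
    obtain ⟨Y, G, f, g, hs, hY, hG⟩ := bassClass.exists_generator hω hM
    exact ⟨Y, G, f, g, hs, hY, hG⟩
  | succ n ih =>
    intro M hM
    obtain ⟨X, W, f, g, hs, hX, hW⟩ := hM.exists_right_approximation ih
    exact BassDim.exists_left_approximation hω hs hX hW

end Bass

/-! ### Cosyzygies of an injective resolution -/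

section Cosyzygy

variable {R : Type u} [Ring R]

lemma exists_isShortExact_cosyzygy {M : ModuleCat.{u} R} (I : InjectiveResolution M) (m : ℕ) :
    ∃ (f : cosyzygy I m ⟶ I.cocomplex.X m) (g : I.cocomplex.X m ⟶ cosyzygy I (m + 1)),
      IsShortExact f g := by
  cases m with
  | zero =>
    let ι : M ⟶ I.cocomplex.X 0 := I.ι.f 0
    refine ⟨ι, _, isShortExact_range ι (I.cocomplex.d 0 1) ?_ fun x => ⟨fun hx => ?_, ?_⟩⟩
    · exact (ModuleCat.mono_iff_injective (I.ι.f 0)).1 inferInstance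
    · exact (ShortComplex.moduleCat_exact_iff _).1 I.exact₀ x hx
    · rintro ⟨y, rfl⟩
      exact ConcreteCategory.congr_hom I.ι_f_zero_comp_complex_d y
  | succ m =>
    let ι : cosyzygy I (m + 1) ⟶ I.cocomplex.X (m + 1) :=
      ModuleCat.ofHom (LinearMap.range (I.cocomplex.d m (m + 1)).hom).subtype
    refine ⟨ι, _, isShortExact_range ι (I.cocomplex.d (m + 1) (m + 2)) Subtype.val_injective
      fun x => ⟨fun hx => ?_, ?_⟩⟩
    · obtain ⟨y, hy⟩ := (cochain_exactAt_succ_iff _ _).1 (I.cocomplex_exactAt_succ m) x hx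
      exact ⟨⟨x, y, hy⟩, rfl⟩
    · rintro ⟨⟨_, y, rfl⟩, rfl⟩
      exact ConcreteCategory.congr_hom (I.cocomplex.d_comp_d m (m + 1) (m + 2)) y

variable {S ω : Type u} [Ring S] [AddCommGroup ω] [Module R ω] [Module Sᵐᵒᵖ ω]
  [SMulCommClass R Sᵐᵒᵖ ω]

lemma ext_cosyzygy {T M : ModuleCat.{u} R} (I : InjectiveResolution M) (m : ℕ) : ∀ i,
    Subsingleton (Abelian.Ext T M (i + 1 + m)) →
      Subsingleton (Abelian.Ext T (cosyzygy I m) (i + 1)) := by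
  induction m with
  | zero => exact fun i h => h
  | succ m ih =>
    intro i h
    obtain ⟨f, g, hs⟩ := exists_isShortExact_cosyzygy I m
    have := I.injective m
    exact hs.ext_right (Abelian.Ext.subsingleton_of_injective _ _ i)
      (ih (i + 1) (by convert h using 2; omega))

lemma CoresLE.cosyzygy (hω : IsSemidualizing R S ω) {n : ℕ} {M : ModuleCat.{u} R}
    (I : InjectiveResolution M) (hM : CoresLE (bassClass R S ω) n M) (m : ℕ) :
    CoresLE (bassClass R S ω) n (cosyzygy I m) := by
  induction m with
  | zero => exact hM
  | succ m ih =>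
    obtain ⟨f, g, hs⟩ := exists_isShortExact_cosyzygy I m
    have := I.injective m
    exact ih.cosyzygy_step hω hs

/-- The injective terms between degrees m and m + k are Bass, so a Bass cosyzygy can close the
coresolution. -/
lemma coresLE_of_cosyzygy (hω : IsSemidualizing R S ω) {M : ModuleCat.{u} R}
    (I : InjectiveResolution M) (k : ℕ) : ∀ m, bassClass R S ω (BassDim.cosyzygy I (m + k)) →
      CoresLE (bassClass R S ω) k (BassDim.cosyzygy I m) := by
  induction k with
  | zero => exact fun m h => h
  | succ k ih =>
    intro m h
    obtain ⟨f, g, hs⟩ := exists_isShortExact_cosyzygy I m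
    have := I.injective m
    exact ⟨_, _, f, g, hs, bassClass_of_injective hω _,
      ih (m + 1) (by rwa [Nat.add_right_comm, Nat.add_assoc])⟩

end Cosyzygy

/-! ### Injective envelopes and minimal injective resolutions -/

section InjectiveEnvelope

variable {R : Type u} [Ring R]

/-- A submodule of an injective module has an injective essential extension inside it. -/
lemma exists_injective_essential_extension (E : ModuleCat.{u} R) [Injective E]
    (M₀ : Submodule R E) : ∃ L : Submodule R E, M₀ ≤ L ∧
      (∀ N ≤ L, N ⊓ M₀ = ⊥ → N = ⊥) ∧ Injective (ModuleCat.of R L) := by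
  obtain ⟨L, ⟨hML, hL⟩, hmax⟩ := zorn_le₀
    {L : Submodule R E | M₀ ≤ L ∧ ∀ N ≤ L, N ⊓ M₀ = ⊥ → N = ⊥} fun c hc hchain => by
      rcases c.eq_empty_or_nonempty with rfl | hne
      · exact ⟨M₀, ⟨le_rfl, fun N hN h => by rwa [inf_eq_left.2 hN] at h⟩, by simp⟩
      · refine ⟨sSup c, ⟨?_, fun N hN h => ?_⟩, fun L hL => le_sSup hL⟩
        · obtain ⟨L, hL⟩ := hne
          exact (hc hL).1.trans (le_sSup hL)
        · rw [Submodule.eq_bot_iff]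
          intro x hx
          obtain ⟨L, hL, hxL⟩ := (Submodule.mem_sSup_of_directed hne hchain.directedOn).1 (hN hx)
          have := (hc hL).2 (Submodule.span R {x}) ((Submodule.span_singleton_le_iff_mem _ _).2 hxL)
            (le_bot_iff.1 ((inf_le_inf_right M₀
              ((Submodule.span_singleton_le_iff_mem _ _).2 hx)).trans h.le))
          exact Submodule.span_singleton_eq_bot.1 this
  -- With L a maximal essential extension of M₀ in E, let K be maximal with K ∩ L = 0. The inclusion
  -- of L then factors through an embedding into E/K and extends to a map φ on E that fixes L and
  -- kills K.
  obtain ⟨K, hKL, hKmax⟩ := zorn_le₀ {K : Submodule R E | K ⊓ L = ⊥} fun c hc hchain => by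
      rcases c.eq_empty_or_nonempty with rfl | hne
      · exact ⟨⊥, bot_inf_eq L, by simp⟩
      · refine ⟨sSup c, ?_, fun L hL => le_sSup hL⟩
        refine (Submodule.eq_bot_iff _).2 fun x hx => ?_
        obtain ⟨K, hK, hxK⟩ := (Submodule.mem_sSup_of_directed hne hchain.directedOn).1 hx.1
        exact (Submodule.eq_bot_iff _).1 (hc hK) x ⟨hxK, hx.2⟩
  obtain ⟨φ', hφ'⟩ := exists_linear_extension E (K.mkQ.comp L.subtype) L.subtype fun x hx => by
    have hxK : (x : E) ∈ K := (Submodule.Quotient.mk_eq_zero K).1 hx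
    exact (Submodule.eq_bot_iff _).1 hKL x ⟨hxK, x.2⟩
  let φ : E →ₗ[R] E := φ'.comp K.mkQ
  have hφL : ∀ x ∈ L, φ x = x := fun x hx => hφ' ⟨x, hx⟩
  have hφK : ∀ x ∈ K, φ x = 0 := fun x hx => by
    have : K.mkQ x = 0 := (Submodule.Quotient.mk_eq_zero K).2 hx
    rw [LinearMap.comp_apply, this, map_zero]
  have hLr : L ≤ LinearMap.range φ := fun x hx => ⟨x, hφL x hx⟩
  -- The image of φ is essential over M₀, hence equal to L by maximality. Indeed, if N in the image
  -- meets M₀ trivially, its preimage contains K and meets L trivially, so it is K and N = 0. Thus φ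
  -- retracts E onto L.
  have hrange : LinearMap.range φ ≤ L := by
    refine hmax ⟨hML.trans hLr, fun N hN h => ?_⟩ hLr
    have hNL : N ⊓ L = ⊥ := hL _ inf_le_right
      (le_bot_iff.1 ((inf_le_inf_right M₀ inf_le_left).trans h.le))
    have hKc : K ≤ N.comap φ := fun x hx => by
      rw [Submodule.mem_comap, hφK x hx]; exact N.zero_mem
    have hcK : N.comap φ ≤ K := hKmax ((Submodule.eq_bot_iff _).2 fun x hx => by
      have hxN : φ x ∈ N := hx.1
      rw [hφL x hx.2] at hxN
      exact (Submodule.eq_bot_iff _).1 hNL x ⟨hxN, hx.2⟩) hKc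
    refine (Submodule.eq_bot_iff _).2 fun y hy => ?_
    obtain ⟨z, rfl⟩ := hN hy
    exact hφK z (hcK hy)
  refine ⟨L, hML, hL, ⟨fun {X Y} u f _ => ?_⟩⟩
  let ι : ModuleCat.of R L ⟶ E := ModuleCat.ofHom L.subtype
  let r : E ⟶ ModuleCat.of R L := ModuleCat.ofHom (φ.codRestrict L fun x => hrange ⟨x, rfl⟩)
  have hr : ι ≫ r = 𝟙 _ := ModuleCat.hom_ext <| LinearMap.ext fun x =>
    Subtype.ext (hφL x x.2)
  exact ⟨Injective.factorThru (u ≫ ι) f ≫ r, by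
    rw [← Category.assoc, Injective.comp_factorThru, Category.assoc, hr, Category.comp_id]⟩

/-- Existence of injective envelopes. -/
lemma exists_injective_envelope (M : ModuleCat.{u} R) :
    ∃ (E : ModuleCat.{u} R) (ι : M ⟶ E), Injective E ∧ Function.Injective ι ∧
      ∀ N : Submodule R E, N ⊓ LinearMap.range ι.hom = ⊥ → N = ⊥ := by
  let E := Injective.under M
  let j : M ⟶ E := Injective.ι M
  have hj : Function.Injective j := (ModuleCat.mono_iff_injective j).1 inferInstance
  obtain ⟨L, hML, hL, hinj⟩ := exists_injective_essential_extension E (LinearMap.range j.hom)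
  refine ⟨ModuleCat.of R L, ModuleCat.ofHom (j.hom.codRestrict L fun m => hML ⟨m, rfl⟩), hinj,
    fun a b hab => hj (congrArg Subtype.val hab), fun N hN => ?_⟩
  have h := hL (N.map L.subtype) (Submodule.map_subtype_le L N) <| by
    refine (Submodule.eq_bot_iff _).2 ?_
    rintro _ ⟨⟨x, hx, rfl⟩, ⟨m, hm⟩⟩
    have : x = 0 := (Submodule.eq_bot_iff _).1 hN x ⟨hx, m, Subtype.ext hm⟩
    rw [this, map_zero]
  refine (Submodule.eq_bot_iff _).2 fun x hx => Subtype.ext ?_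
  exact (Submodule.eq_bot_iff _).1 h x ⟨x, hx, rfl⟩

variable (R) in
/-- A choice of injective envelopes. -/
structure EnvelopeChoice where
  E : ModuleCat.{u} R → ModuleCat.{u} R
  ι : ∀ M, M ⟶ E M
  injective : ∀ M, Injective (E M)
  mono : ∀ M, Function.Injective (ι M)
  essential : ∀ M (N : Submodule R (E M)), N ⊓ LinearMap.range (ι M).hom = ⊥ → N = ⊥

lemma nonempty_envelopeChoice : Nonempty (EnvelopeChoice R) := by
  choose E ι h₁ h₂ h₃ using exists_injective_envelope (R := R)
  exact ⟨⟨E, ι, h₁, h₂, h₃⟩⟩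

namespace EnvelopeChoice

variable (c : EnvelopeChoice R) (M : ModuleCat.{u} R)

/-- The iterated cokernels of the injective envelopes. -/
def syz : ℕ → ModuleCat.{u} R
  | 0 => M
  | n + 1 => ModuleCat.of R (c.E (syz n) ⧸ LinearMap.range (c.ι (syz n)).hom)

/-- The differential of the minimal injective resolution. -/
def diff (n : ℕ) : c.E (c.syz M n) ⟶ c.E (c.syz M (n + 1)) :=
  ModuleCat.ofHom (LinearMap.range (c.ι (c.syz M n)).hom).mkQ ≫ c.ι (c.syz M (n + 1))

lemma diff_eq_zero_iff (n : ℕ) (x : c.E (c.syz M n)) :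
    c.diff M n x = 0 ↔ ∃ m, c.ι (c.syz M n) m = x := by
  have : c.diff M n x = 0 ↔ (LinearMap.range (c.ι (c.syz M n)).hom).mkQ x = 0 :=
    ⟨fun h => c.mono _ (h.trans (map_zero (c.ι (c.syz M (n + 1))).hom).symm),
      fun h => (congrArg (c.ι (c.syz M (n + 1))) h).trans (map_zero _)⟩
  rw [this]
  exact Submodule.Quotient.mk_eq_zero _

/-- The complex underlying the minimal injective resolution. -/
def complex : CochainComplex (ModuleCat.{u} R) ℕ :=
  CochainComplex.of (fun n => c.E (c.syz M n)) (c.diff M) fun n =>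
    ModuleCat.hom_ext <| LinearMap.ext fun x =>
      (c.diff_eq_zero_iff M (n + 1) _).2 ⟨Submodule.Quotient.mk x, rfl⟩

lemma complex_d (n : ℕ) : (c.complex M).d n (n + 1) = c.diff M n :=
  CochainComplex.of_d (fun n => c.E (c.syz M n)) (c.diff M) n

/-- The minimal injective resolution. -/
def resolution : InjectiveResolution M :=
  injectiveResolutionOfExact (c.complex M) (fun n => c.injective (c.syz M n)) (c.ι M) (c.mono M)
    (fun x => by
      rw [complex_d]
      exact c.diff_eq_zero_iff M 0 x)
    (fun n => by
      rw [cochain_exactAt_succ_iff]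
      intro x hx
      rw [complex_d] at hx
      obtain ⟨m, rfl⟩ := (c.diff_eq_zero_iff M (n + 1) x).1 hx
      obtain ⟨y, rfl⟩ := Submodule.mkQ_surjective _ m
      refine ⟨y, ?_⟩
      rw [complex_d]
      rfl)

lemma isMinimal_resolution : IsMinimal (c.resolution M) := by
  intro i N hN
  refine c.essential (c.syz M i) N ?_
  refine Eq.trans (congrArg (N ⊓ ·) ?_) hN
  refine Submodule.ext fun x => (c.diff_eq_zero_iff M i x).symm.trans ?_
  rw [← complex_d]
  exact Iff.rfl

end EnvelopeChoice

/-- Every module has a minimal injective resolution. -/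
lemma exists_isMinimal (M : ModuleCat.{u} R) : ∃ I : InjectiveResolution M, IsMinimal I := by
  obtain ⟨c⟩ := nonempty_envelopeChoice (R := R)
  exact ⟨c.resolution M, c.isMinimal_resolution M⟩

end InjectiveEnvelope

section OmegaProj

variable {R S ω : Type u} [Ring R] [Ring S] [AddCommGroup ω] [Module R ω] [Module Sᵐᵒᵖ ω]
  [SMulCommClass R Sᵐᵒᵖ ω]

lemma omegaProj_of_iso (X Y : ModuleCat.{u} R) (e : X ≅ Y) (hX : omegaProj R S ω X) :
    omegaProj R S ω Y := by
  obtain ⟨P, hP, ⟨i⟩⟩ := hX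
  exact ⟨P, hP, ⟨e.symm.trans i⟩⟩

open scoped TensorProduct in
lemma omegaProj_of_isZero (Z : ModuleCat.{u} R) (hZ : IsZero Z) : omegaProj R S ω Z := by
  refine ⟨ModuleCat.of S PUnit.{u + 1}, inferInstanceAs (Module.Projective S PUnit.{u + 1}), ⟨hZ.iso ?_⟩⟩
  have h : ∀ t : BiTensor R S ω PUnit.{u + 1}, t = 0 := fun t =>
    DFunLike.congr_fun (tensor_hom_ext R ω (g := LinearMap.id) (h := 0) fun x n =>
      congrArg Submodule.Quotient.mk (TensorProduct.tmul_zero PUnit.{u + 1} x)) t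
  have : Subsingleton (BiTensor R S ω PUnit.{u + 1}) := ⟨fun a b => (h a).trans (h b).symm⟩
  exact ModuleCat.isZero_of_subsingleton _

end OmegaProj

end

end BassDim

/-! ### The equivalences -/

theorem theorem4p2 (R S ω : Type u) [Ring R] [Ring S] [AddCommGroup ω] [Module R ω]
    [Module Sᵐᵒᵖ ω] [SMulCommClass R Sᵐᵒᵖ ω] (hω : BassDim.IsSemidualizing R S ω)
    (M : ModuleCat.{u} R) (hM : BassDim.injDim (BassDim.bassClass R S ω) M < ⊤) (n : ℕ) :
    List.TFAE [
      BassDim.injDim (BassDim.bassClass R S ω) M ≤ n,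
      ∀ I : InjectiveResolution M, BassDim.IsMinimal I →
        ∀ m : ℕ, n ≤ m → BassDim.bassClass R S ω (BassDim.cosyzygy I m),
      ∃ I : InjectiveResolution M, BassDim.IsMinimal I ∧
        ∀ m : ℕ, n ≤ m → BassDim.bassClass R S ω (BassDim.cosyzygy I m),
      ∀ i : ℕ, n + 1 ≤ i → Subsingleton (Abelian.Ext (ModuleCat.of R ω) M i),
      ∃ (X W : ModuleCat.{u} R) (f : M ⟶ X) (g : X ⟶ W) (w : f ≫ g = 0),
        (ShortComplex.mk f g w).ShortExact ∧ BassDim.bassClass R S ω X ∧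
          BassDim.InjDimLESubOne (BassDim.omegaProj R S ω) W n,
      ∃ (X W : ModuleCat.{u} R) (f : X ⟶ W) (g : W ⟶ M) (w : f ≫ g = 0),
        (ShortComplex.mk f g w).ShortExact ∧ BassDim.bassClass R S ω X ∧
          BassDim.injDim (BassDim.omegaProj R S ω) W ≤ n] := by
  open BassDim in
  have hB (N : ModuleCat.{u} R) (k : ℕ) :
      injDim (bassClass R S ω) N ≤ k ↔ CoresLE (bassClass R S ω) k N :=
    injDim_le_iff (fun Z hZ => bassClass_of_isZero hω hZ)
      (fun X Y e hX => bassClass_of_iso hω e hX) N k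
  have hP (N : ModuleCat.{u} R) (k : ℕ) :
      injDim (omegaProj R S ω) N ≤ k ↔ CoresLE (omegaProj R S ω) k N :=
    injDim_le_iff omegaProj_of_isZero omegaProj_of_iso N k
  have hPB (N : ModuleCat.{u} R) (k : ℕ) (h : CoresLE (omegaProj R S ω) k N) :
      CoresLE (bassClass R S ω) k N := h.mono_class fun X hX => bassClass_of_omegaProj hω hX
  obtain ⟨N, hN⟩ : ∃ N : ℕ, CoresLE (bassClass R S ω) N M := by
    obtain ⟨N, hN⟩ := ENat.ne_top_iff_exists.1 hM.ne
    exact ⟨N, (hB M N).1 hN.symm.le⟩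
  tfae_have 1 → 4 := fun h => ((hB M n).1 h).ext_eq_zero
  tfae_have 4 → 2 := fun h I _ m hm => by
    -- Any finite bound N on the Bass dimension of M will do: the Ext vanishing brings the cosyzygy
    -- down to dimension zero.
    refine (hN.cosyzygy hω I m).bassClass_of_ext fun i hi => ?_
    obtain ⟨j, rfl⟩ := Nat.exists_eq_add_of_le' hi
    exact ext_cosyzygy I m j (h _ (by omega))
  tfae_have 2 → 3 := fun h => by
    obtain ⟨I, hI⟩ := exists_isMinimal M
    exact ⟨I, hI, h I hI⟩
  tfae_have 3 → 1 := fun ⟨I, _, h⟩ =>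
    (hB M n).2 (coresLE_of_cosyzygy hω I n 0 (h _ (by omega)))
  tfae_have 1 → 5 := fun h => by
    rw [hB] at h
    cases n with
    | zero =>
      -- For n = 0 the bound n - 1 on W means W = 0, so X = M.
      have hs := isShortExact_iso_zero (isZero_zero (ModuleCat.{u} R)) (Iso.refl M)
      exact ⟨M, _, _, _, _, hs.shortExact, h, isZero_zero _⟩
    | succ n =>
      obtain ⟨X, W, f, g, hs, hX, hW⟩ :=
        h.exists_right_approximation (CoresLE.exists_left_approximation hω)
      exact ⟨X, W, f, g, _, hs.shortExact, hX, (hP W n).2 hW⟩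
  tfae_have 5 → 1 := fun ⟨X, W, f, g, w, hs, hX, hW⟩ => by
    rw [hB]
    have hs := IsShortExact.of_shortExact hs
    cases n with
    | zero =>
      exact bassClass.kernel hs (hs.ext_one_left (fun u => ⟨0, IsZero.eq_of_tgt hW _ _⟩)
        (hX.ext_eq_zero 1 le_rfl)) hX (bassClass_of_isZero hω hW)
    | succ n => exact ⟨X, W, f, g, hs, hX, hPB W n ((hP W n).1 hW)⟩
  tfae_have 1 → 6 := fun h => by
    obtain ⟨X, W, f, g, hs, hX, hW⟩ := ((hB M n).1 h).exists_left_approximation hω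
    exact ⟨X, W, f, g, _, hs.shortExact, hX, (hP W n).2 hW⟩
  tfae_have 6 → 4 := fun ⟨X, W, f, g, w, hs, hX, hW⟩ i hi =>
    -- Ext^i_R(ω, M) lies between Ext^i_R(ω, W), zero for i > n, and Ext^{i+1}_R(ω, X) = 0.
    (IsShortExact.of_shortExact hs).ext_right ((hPB W n ((hP W n).1 hW)).ext_eq_zero i hi)
      (hX.ext_eq_zero (i + 1) (by omega))
  tfae_finish
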